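/- Conventions. All quasi-Banach spaces are complete for a quasinorm which, for some $0<r\le 1$, is an $r$-norm: $\|x+y\|^r\le\|x\|^r+\|y\|^r$. A complex quasi-Banach space $X$ is called natural if it is linearly isomorphic to a closed linear subspace of a complex quasi-Banach lattice $Y$ which is $q$-convex for some $q>0$, that is, for some constant $C$, $$\Big\|\Big(\sum_{k=1}^n|y_k|^q\Big)^{1/q}\Big\|\le C\Big(\sum_{k=1}^n\|y_k\|^q\Big)^{1/q}\qquad\text{for all } n \text{ and all } y_1,\dots,y_n\in Y.$$ Let $G$ be a compact (Hausdorff) abelian group with dual group $\Gamma$. A subset $E\subset\Gamma$ is a Sidon set if there is a constant $M$ such that $\sum_{\gamma\in E}|a(\gamma)|\le M\max_{g\in G}\big|\sum_{\gamma\in E}a(\gamma)\gamma(g)\big|$ for every finitely supported $a:E\to\mathbb C$. Let $\epsilon_k$, $k\ge 1$, denote the coordinate functions on the Cantor group $\Delta=\{\pm1\}^{\mathbb N}$. For a function $\phi$ from a compact group into $X$, $\|\phi\|_p$ denotes the $L_p$-quasinorm of $\|\phi(\cdot)\|_X$ with respect to normalized Haar measure (the essential supremum if $p=\infty$). Theorem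 4. Let $X$ be a natural quasi-Banach space and let $0<p\le\infty$. Then every Sidon set $E\subset\Gamma$ has property $\mathcal C_p(X)$: there is a constant $M>0$ such that for every finite subset $\{\gamma_1,\dots,\gamma_n\}$ of $E$ (the $\gamma_k$ being distinct) and all $x_1,\dots,x_n\in X$, $$M^{-1}\Big\|\sum_{k=1}^n x_k\epsilon_k\Big\|_p\le\Big\|\sum_{k=1}^n x_k\gamma_k\Big\|_p\le M\Big\|\sum_{k=1}^n x_k\epsilon_k\Big\|_p .$$ -/

import Mathlib

open MeasureTheory Filter Topology
open scoped ENNReal NNReal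

set_option linter.unusedSectionVars false

/-! ### Quasi-Banach spaces and quasi-Banach lattices -/

/-- A quasi-Banach space over `𝕜`, with quasinorm `qnorm`.  The quasinorm is an `r`-norm for some
`0 < r ≤ 1`, and the space is complete for it (every Cauchy sequence converges). -/
class QuasiBanachSpace (𝕜 : Type*) (X : Type*) [NormedField 𝕜] [AddCommGroup X] [Module 𝕜 X] where
  /-- the quasinorm -/
  qnorm : X → ℝ
  qnorm_nonneg : ∀ x, 0 ≤ qnorm x
  eq_zero_of_qnorm_eq_zero : ∀ x, qnorm x = 0 → x = 0
  qnorm_smul : ∀ (c : 𝕜) (x : X), qnorm (c • x) = ‖c‖ * qnorm x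
  exists_rnorm : ∃ r : ℝ, 0 < r ∧ r ≤ 1 ∧
    ∀ x y, qnorm (x + y) ^ r ≤ qnorm x ^ r + qnorm y ^ r
  complete : ∀ u : ℕ → X,
    (∀ ε : ℝ, 0 < ε → ∃ n₀, ∀ m ≥ n₀, ∀ n ≥ n₀, qnorm (u m - u n) < ε) →
      ∃ x, Tendsto (fun n => qnorm (u n - x)) atTop (𝓝 0)

/-- A (real) quasi-Banach lattice: a real vector lattice with a complete lattice quasinorm. -/
class QuasiBanachLattice (L : Type*) [AddCommGroup L] [Module ℝ L] [Lattice L] extends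
    QuasiBanachSpace ℝ L, IsOrderedAddMonoid L, PosSMulMono ℝ L where
  qnorm_solid : ∀ x y : L, |x| ≤ |y| → qnorm x ≤ qnorm y

/-- The quasinorm of a real quasi-Banach lattice. -/
abbrev lnorm {L : Type*} [AddCommGroup L] [Module ℝ L] [Lattice L] [QuasiBanachLattice L]
    (x : L) : ℝ :=
  QuasiBanachSpace.qnorm ℝ x

/-! ### Krivine's functional calculus -/

/-- Continuous positively homogeneous functions (of degree one) on `ℝⁿ`. -/
def IsContHomog {n : ℕ} (f : (Fin n → ℝ) → ℝ) : Prop :=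
  Continuous f ∧ ∀ (c : ℝ) (t : Fin n → ℝ), 0 ≤ c → f (c • t) = c * f t

/-- `Φ` is a Krivine functional calculus at the tuple `y`: on continuous positively homogeneous
functions it is a linear lattice homomorphism, and it sends the `k`-th coordinate to `y k`.
(The values of `Φ` at other functions are irrelevant.) -/
structure IsKrivineCalculus {L : Type*} [AddCommGroup L] [Module ℝ L] [Lattice L] {n : ℕ}
    (y : Fin n → L) (Φ : ((Fin n → ℝ) → ℝ) → L) : Prop where
  coord : ∀ k, Φ (fun t => t k) = y k
  add : ∀ f g, IsContHomog f → IsContHomog g → Φ (f + g) = Φ f + Φ g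
  smul : ∀ (c : ℝ) f, IsContHomog f → Φ (c • f) = c • Φ f
  sup : ∀ f g, IsContHomog f → IsContHomog g → Φ (f ⊔ g) = Φ f ⊔ Φ g

namespace Krivine

variable {L : Type*} [AddCommGroup L] [Module ℝ L] [Lattice L]

/-- Graph of the map sending a lattice-linear expression in the coordinates of `ℝⁿ` to the same
expression in `y`. -/
def graph {n : ℕ} (y : Fin n → L) : Set (((Fin n → ℝ) → ℝ) × L) :=
  latticeClosure (Set.range fun a : Fin n → ℝ =>
    ((fun t : Fin n → ℝ => ∑ k, a k * t k), ∑ k, a k • y k))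

theorem lin_mem {n : ℕ} (y : Fin n → L) (a : Fin n → ℝ) :
    ((fun t : Fin n → ℝ => ∑ k, a k * t k), ∑ k, a k • y k) ∈ graph y :=
  subset_latticeClosure ⟨a, rfl⟩

theorem sup_mem {n : ℕ} {y : Fin n → L} {p q} (hp : p ∈ graph y) (hq : q ∈ graph y) :
    p ⊔ q ∈ graph y := isSublattice_latticeClosure.1 hp hq

theorem inf_mem {n : ℕ} {y : Fin n → L} {p q} (hp : p ∈ graph y) (hq : q ∈ graph y) :
    p ⊓ q ∈ graph y := isSublattice_latticeClosure.2 hp hq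

theorem isContHomog {n : ℕ} {y : Fin n → L} {p} (hp : p ∈ graph y) : IsContHomog p.1 := by
  refine latticeClosure_min (t := {p : ((Fin n → ℝ) → ℝ) × L | IsContHomog p.1}) ?_ ⟨?_, ?_⟩ hp
  · rintro _ ⟨a, rfl⟩
    refine ⟨by dsimp only; fun_prop, fun c t _ => ?_⟩
    simp only [Pi.smul_apply, smul_eq_mul, Finset.mul_sum]
    exact Finset.sum_congr rfl fun k _ => by ring
  · rintro p ⟨hp1, hp2⟩ q ⟨hq1, hq2⟩
    refine ⟨hp1.sup hq1, fun c t hc => ?_⟩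
    change max (p.1 (c • t)) (q.1 (c • t)) = c * max (p.1 t) (q.1 t)
    rw [hp2 c t hc, hq2 c t hc, mul_max_of_nonneg _ _ hc]
  · rintro p ⟨hp1, hp2⟩ q ⟨hq1, hq2⟩
    refine ⟨hp1.inf hq1, fun c t hc => ?_⟩
    change min (p.1 (c • t)) (q.1 (c • t)) = c * min (p.1 t) (q.1 t)
    rw [hp2 c t hc, hq2 c t hc, mul_min_of_nonneg _ _ hc]

section

variable [IsOrderedAddMonoid L] [PosSMulMono ℝ L]

theorem smul_sup_of_pos {c : ℝ} (hc : 0 < c) (x y : L) : c • (x ⊔ y) = c • x ⊔ c • y :=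
  (OrderIso.smulRight (β := L) hc).map_sup x y

theorem smul_inf_of_pos {c : ℝ} (hc : 0 < c) (x y : L) : c • (x ⊓ y) = c • x ⊓ c • y :=
  (OrderIso.smulRight (β := L) hc).map_inf x y

theorem add_mem {n : ℕ} {y : Fin n → L} {p q} (hp : p ∈ graph y) (hq : q ∈ graph y) :
    p + q ∈ graph y := by
  have h1 : ∀ a : Fin n → ℝ, ∀ q ∈ graph y,
      ((fun t : Fin n → ℝ => ∑ k, a k * t k), ∑ k, a k • y k) + q ∈ graph y := by
    intro a q hq
    refine latticeClosure_min (t := {q | ((fun t : Fin n → ℝ => ∑ k, a k * t k),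
      ∑ k, a k • y k) + q ∈ graph y}) ?_ ⟨?_, ?_⟩ hq
    · rintro _ ⟨b, rfl⟩
      have := lin_mem y (a + b)
      simpa [Finset.sum_add_distrib, add_mul, add_smul, Pi.add_def] using this
    · intro p hp q hq
      simp only [Set.mem_ofPred_eq] at *
      rw [add_sup]; exact sup_mem hp hq
    · intro p hp q hq
      simp only [Set.mem_ofPred_eq] at *
      rw [add_inf]; exact inf_mem hp hq
  refine latticeClosure_min (t := {p | p + q ∈ graph y}) ?_ ⟨?_, ?_⟩ hp
  · rintro _ ⟨a, rfl⟩
    exact h1 a q hq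
  · intro p hp q hq
    simp only [Set.mem_ofPred_eq] at *
    rw [sup_add]; exact sup_mem hp hq
  · intro p hp q hq
    simp only [Set.mem_ofPred_eq] at *
    rw [inf_add]; exact inf_mem hp hq

theorem neg_mem {n : ℕ} {y : Fin n → L} {p} (hp : p ∈ graph y) : -p ∈ graph y := by
  refine latticeClosure_min (t := {p | -p ∈ graph y}) ?_ ⟨?_, ?_⟩ hp
  · rintro _ ⟨a, rfl⟩
    have := lin_mem y (-a)
    simpa [Pi.neg_def] using this
  · intro p hp q hq
    simp only [Set.mem_ofPred_eq] at *
    rw [neg_sup]; exact inf_mem hp hq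
  · intro p hp q hq
    simp only [Set.mem_ofPred_eq] at *
    rw [neg_inf]; exact sup_mem hp hq

theorem smul_mem {n : ℕ} {y : Fin n → L} {c : ℝ} (hc : 0 < c) {p} (hp : p ∈ graph y) :
    c • p ∈ graph y := by
  have e1 : ∀ p q : ((Fin n → ℝ) → ℝ) × L, c • (p ⊔ q) = c • p ⊔ c • q := fun p q =>
    Prod.ext (smul_sup_of_pos hc _ _) (smul_sup_of_pos hc _ _)
  have e2 : ∀ p q : ((Fin n → ℝ) → ℝ) × L, c • (p ⊓ q) = c • p ⊓ c • q := fun p q =>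
    Prod.ext (smul_inf_of_pos hc _ _) (smul_inf_of_pos hc _ _)
  refine latticeClosure_min (t := {p | c • p ∈ graph y}) ?_ ⟨?_, ?_⟩ hp
  · rintro _ ⟨a, rfl⟩
    have := lin_mem y (c • a)
    simpa [Pi.smul_def, Finset.mul_sum, Finset.smul_sum, smul_smul, mul_assoc] using this
  · intro p hp q hq
    simp only [Set.mem_ofPred_eq] at *
    rw [e1]; exact sup_mem hp hq
  · intro p hp q hq
    simp only [Set.mem_ofPred_eq] at *
    rw [e2]; exact inf_mem hp hq

theorem coord_mem {n : ℕ} (y : Fin n → L) (k : Fin n) :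
    ((fun t : Fin n → ℝ => t k), y k) ∈ graph y := by
  have := lin_mem y (Pi.single k 1)
  simpa [Pi.single_apply] using this

theorem unit_mem {n : ℕ} (y : Fin n → L) :
    ((fun t : Fin n → ℝ => ∑ k, |t k|), ∑ k, |y k|) ∈ graph y := by
  have h : ∀ s : Finset (Fin n),
      ((fun t : Fin n → ℝ => ∑ k ∈ s, |t k|), ∑ k ∈ s, |y k|) ∈ graph y := by
    intro s
    induction s using Finset.induction_on with
    | empty => simpa using lin_mem y 0
    | insert k s hk ih =>
      have := add_mem (sup_mem (coord_mem y k) (neg_mem (coord_mem y k))) ih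
      simp only [Finset.sum_insert hk]
      exact this
  exact h Finset.univ

/-- Lattice-linear inequalities valid in `ℝ` are valid in every vector lattice. -/
theorem nonneg_of_nonneg {n : ℕ} {y : Fin n → L} {p} (hp : p ∈ graph y) (h0 : 0 ≤ p.1) :
    0 ≤ p.2 := by
  let _ : DistribLattice (((Fin n → ℝ) → ℝ) × L) := AddCommGroup.toDistribLattice _
  set V : Set (((Fin n → ℝ) → ℝ) × L) := Set.range fun a : Fin n → ℝ =>
    ((fun t : Fin n → ℝ => ∑ k, a k * t k), ∑ k, a k • y k) with hV
  have key : ∀ q ∈ supClosure V, 0 ≤ q.1 → 0 ≤ q.2 := by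
    rintro _ ⟨T, hT, hTV, rfl⟩ hq
    set q := T.sup' hT id with hqdef
    let S : Set (Fin n → ℝ) := {a | ((fun t : Fin n → ℝ => ∑ k, a k * t k), ∑ k, a k • y k) ∈ T}
    let C : Set (Fin n → ℝ) := {a | ∑ k, a k • y k ≤ q.2}
    have hSC : S ⊆ C := fun a ha => (Finset.le_sup' id (Finset.mem_coe.1 ha)).2
    have hC : Convex ℝ C := by
      intro a ha b hb s t hs ht hst
      have h1 := add_le_add (smul_le_smul_of_nonneg_left (show _ ≤ q.2 from ha) hs)
        (smul_le_smul_of_nonneg_left (show _ ≤ q.2 from hb) ht)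
      rw [← add_smul, hst, one_smul] at h1
      change ∑ k, (s • a + t • b) k • y k ≤ q.2
      simpa [Finset.smul_sum, smul_smul, add_smul, Finset.sum_add_distrib] using h1
    have hSfin : S.Finite := by
      refine Set.Finite.of_finite_image (f := fun a : Fin n → ℝ => fun t : Fin n → ℝ =>
        ∑ k, a k * t k) ((T.finite_toSet.image Prod.fst).subset ?_) ?_
      · rintro _ ⟨a, ha, rfl⟩
        exact ⟨_, ha, rfl⟩
      · intro a _ b _ hab
        funext k
        have := congrFun hab (Pi.single k 1)
        simpa [Pi.single_apply] using this
    have h0mem : (0 : Fin n → ℝ) ∈ convexHull ℝ S := by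
      by_contra hcon
      obtain ⟨f, u, hu, hf⟩ := geometric_hahn_banach_point_closed (convex_convexHull ℝ S)
        (hSfin.isCompact_convexHull (𝕜 := ℝ)).isClosed hcon
      rw [map_zero] at hu
      let t : Fin n → ℝ := fun k => - f (Pi.single k 1)
      have hft : ∀ a : Fin n → ℝ, ∑ k, a k * t k = - f a := by
        intro a
        conv_rhs => rw [← Finset.univ_sum_single a, map_sum, ← Finset.sum_neg_distrib]
        refine Finset.sum_congr rfl fun k _ => ?_
        have : (Pi.single k (a k) : Fin n → ℝ) = a k • Pi.single k 1 := by
          rw [← Pi.single_smul]; simp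
        rw [this, map_smul]; simp [t]
      have hlt : q.1 t < 0 := by
        rw [hqdef]
        refine Finset.sup'_induction (p := fun v => v.1 t < 0) hT id
          (fun a ha b hb => ?_) (fun v hv => ?_)
        · exact max_lt ha hb
        · obtain ⟨a, rfl⟩ := hTV hv
          have := hf a (subset_convexHull ℝ S hv)
          change ∑ k, a k * t k < 0
          rw [hft]; linarith
      exact absurd (hq t) (not_le.2 hlt)
    have := convexHull_min hSC hC h0mem
    simpa [C] using this
  have hp' : p ∈ infClosure (supClosure V) := by
    rw [infClosure_supClosure]; exact hp
  obtain ⟨T, hT, hTV, rfl⟩ := hp'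
  have : (((T.inf' hT id).1, 0) : ((Fin n → ℝ) → ℝ) × L) ≤ T.inf' hT id := by
    refine Finset.le_inf' hT id fun q hq => ?_
    have hle : T.inf' hT id ≤ q := Finset.inf'_le id hq
    exact ⟨hle.1, key q (hTV hq) (h0.trans hle.1)⟩
  exact this.2

theorem le_of_le {n : ℕ} {y : Fin n → L} {p q} (hp : p ∈ graph y) (hq : q ∈ graph y)
    (h : p.1 ≤ q.1) : p.2 ≤ q.2 := by
  have := nonneg_of_nonneg (add_mem hq (neg_mem hp)) (by
    change 0 ≤ q.1 + -p.1
    rw [← sub_eq_add_neg]; exact sub_nonneg.2 h)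
  change 0 ≤ q.2 + -p.2 at this
  rwa [← sub_eq_add_neg, sub_nonneg] at this

end

/-- Uniform approximation by lattice-linear expressions. -/
theorem exists_approx {n : ℕ} [IsOrderedAddMonoid L] [PosSMulMono ℝ L] (y : Fin n → L)
    {f : (Fin n → ℝ) → ℝ} (hf : IsContHomog f) {ε : ℝ} (hε : 0 < ε) :
    ∃ p ∈ graph y, ∀ t, |f t - p.1 t| ≤ ε * ∑ k, |t k| := by
  let K : Set (Fin n → ℝ) := {t | ∑ k, |t k| = 1}
  have hKc : IsCompact K := by
    refine Metric.isCompact_of_isClosed_isBounded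
      (isClosed_eq (by fun_prop) continuous_const) ?_
    refine (Metric.isBounded_closedBall (x := (0 : Fin n → ℝ)) (r := 1)).subset fun t ht => ?_
    rw [mem_closedBall_zero_iff, pi_norm_le_iff_of_nonneg zero_le_one]
    intro k
    rw [Real.norm_eq_abs, ← (show ∑ k, |t k| = 1 from ht)]
    exact Finset.single_le_sum (f := fun k => |t k|) (fun _ _ => abs_nonneg _)
      (Finset.mem_univ k)
  have : CompactSpace K := isCompact_iff_compactSpace.1 hKc
  let A : Set C(K, ℝ) := {g | ∃ p ∈ graph y, ∀ x : K, g x = p.1 x}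
  have hA : closure A = ⊤ := by
    refine ContinuousMap.sublattice_closure_eq_top A ⟨0, _, lin_mem y 0, fun x => by simp⟩ ?_ ?_ ?_
    · rintro g ⟨p, hp, hgp⟩ h ⟨q, hq, hhq⟩
      exact ⟨p ⊓ q, inf_mem hp hq, fun x => by
        change min (g x) (h x) = min (p.1 x) (q.1 x)
        rw [hgp, hhq]⟩
    · rintro g ⟨p, hp, hgp⟩ h ⟨q, hq, hhq⟩
      exact ⟨p ⊔ q, sup_mem hp hq, fun x => by
        change max (g x) (h x) = max (p.1 x) (q.1 x)
        rw [hgp, hhq]⟩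
    · intro v x z
      have hsm : ∀ (c : ℝ) {p}, p ∈ graph y → c • p ∈ graph y := by
        intro c p hp
        rcases lt_trichotomy c 0 with hc | rfl | hc
        · have := neg_mem (smul_mem (neg_pos.2 hc) hp)
          simpa using this
        · have := lin_mem y 0
          simp only [Pi.zero_apply, zero_mul, zero_smul, Finset.sum_const_zero] at this
          rw [zero_smul]; exact this
        · exact smul_mem hc hp
      have hmem : ∀ p, p ∈ graph y → p.1 x = v x → p.1 z = v z →
          ∃ g ∈ A, g x = v x ∧ g z = v z := fun p hp h1 h2 =>
        ⟨⟨fun w : K => p.1 w, (isContHomog hp).1.comp continuous_subtype_val⟩,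
          ⟨p, hp, fun _ => rfl⟩, h1, h2⟩
      have ux : ∑ k, |x.1 k| = 1 := x.2
      have uz : ∑ k, |z.1 k| = 1 := z.2
      by_cases hxz : x = z
      · subst hxz
        refine hmem _ (hsm (v x) (unit_mem y)) ?_ ?_ <;> simp [ux]
      · obtain ⟨k, hk⟩ : ∃ k, x.1 k ≠ z.1 k := by
          by_contra hcon
          push Not at hcon
          exact hxz (Subtype.ext (funext hcon))
        have hk' : x.1 k - z.1 k ≠ 0 := sub_ne_zero.2 hk
        set b : ℝ := (v x - v z) / (x.1 k - z.1 k) with hb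
        have hbe : b * (x.1 k - z.1 k) = v x - v z := by rw [hb]; field_simp
        refine hmem _ (add_mem (hsm b (coord_mem y k))
          (hsm (v x - b * x.1 k) (unit_mem y))) ?_ ?_
        · simp [ux]
        · simp [uz]; linarith
  let F : C(K, ℝ) := ⟨fun x => f x, hf.1.comp continuous_subtype_val⟩
  have hF : F ∈ closure A := by rw [hA]; trivial
  obtain ⟨g, ⟨p, hp, hgp⟩, hg⟩ := Metric.mem_closure_iff.1 hF ε hε
  refine ⟨p, hp, fun t => ?_⟩
  have hp0 := isContHomog hp
  set s := ∑ k, |t k| with hs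
  have hs0 : 0 ≤ s := Finset.sum_nonneg fun _ _ => abs_nonneg _
  rcases hs0.eq_or_lt with h0 | h0
  · have ht : t = (0 : ℝ) • t := by
      rw [zero_smul]
      funext k
      have := (Finset.sum_eq_zero_iff_of_nonneg (fun _ _ => abs_nonneg _)).1 (hs.symm.trans h0.symm)
        k (Finset.mem_univ k)
      simpa using this
    rw [← h0, ht, hf.2 0 t le_rfl, hp0.2 0 t le_rfl]; simp
  · have hx : s⁻¹ • t ∈ K := by
      change ∑ k, |(s⁻¹ • t) k| = 1
      simp only [Pi.smul_apply, smul_eq_mul, abs_mul, abs_of_pos (inv_pos.2 h0)]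
      rw [← Finset.mul_sum, ← hs, inv_mul_cancel₀ h0.ne']
    have ht : t = s • (s⁻¹ • t) := by rw [smul_smul, mul_inv_cancel₀ h0.ne', one_smul]
    have hd := (ContinuousMap.dist_lt_iff hε).1 hg ⟨_, hx⟩
    rw [hgp, Real.dist_eq] at hd
    change |f (s⁻¹ • t) - p.1 (s⁻¹ • t)| < ε at hd
    rw [ht, hf.2 s _ hs0, hp0.2 s _ hs0, ← mul_sub, abs_mul, abs_of_pos h0, mul_comm ε]
    exact mul_le_mul_of_nonneg_left hd.le hs0

/-- `z` is the uniform limit of values of lattice-linear expressions approximating `f`. -/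
def Approx {n : ℕ} (y : Fin n → L) (f : (Fin n → ℝ) → ℝ) (z : L) : Prop :=
  ∀ ε : ℝ, 0 < ε → ∃ p ∈ graph y, (∀ t, |f t - p.1 t| ≤ ε * ∑ k, |t k|) ∧
    z ≤ p.2 + ε • ∑ k, |y k| ∧ p.2 ≤ z + ε • ∑ k, |y k|

variable [QuasiBanachLattice L]

theorem lnorm_zero : lnorm (0 : L) = 0 := by
  have := QuasiBanachSpace.qnorm_smul (0 : ℝ) (0 : L)
  simpa using this

theorem lnorm_mono {x y : L} (hx : 0 ≤ x) (hxy : x ≤ y) : lnorm x ≤ lnorm y :=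
  QuasiBanachLattice.qnorm_solid x y (by
    rwa [abs_of_nonneg hx, abs_of_nonneg (hx.trans hxy)])

theorem nonpos_of_lnorm {x : L} (h : ∀ ε : ℝ, 0 < ε → ∃ z, x ≤ z ∧ lnorm z ≤ ε) : x ≤ 0 := by
  have h0 : lnorm (x ⊔ 0) ≤ 0 := by
    refine le_of_forall_pos_le_add fun ε hε => ?_
    obtain ⟨z, hxz, hz⟩ := h ε hε
    have h1 : lnorm (x ⊔ 0) ≤ lnorm |z| :=
      lnorm_mono le_sup_right (sup_le (hxz.trans (le_abs_self z)) (abs_nonneg z))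
    have h2 : lnorm |z| ≤ lnorm z := QuasiBanachLattice.qnorm_solid _ _ (by rw [abs_abs])
    linarith
  have := QuasiBanachSpace.eq_zero_of_qnorm_eq_zero (𝕜 := ℝ) (x ⊔ 0)
    (le_antisymm h0 (QuasiBanachSpace.qnorm_nonneg _))
  exact sup_eq_right.1 this

theorem nonpos_of_smul {x u : L} (h : ∀ ε : ℝ, 0 < ε → x ≤ ε • u) : x ≤ 0 := by
  refine nonpos_of_lnorm fun ε hε => ?_
  have hu : 0 ≤ lnorm u := QuasiBanachSpace.qnorm_nonneg _
  refine ⟨(ε / (lnorm u + 1)) • u, h _ (by positivity), ?_⟩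
  have := QuasiBanachSpace.qnorm_smul (ε / (lnorm u + 1)) u
  rw [Real.norm_of_nonneg (by positivity)] at this
  change lnorm _ = _ * lnorm u at this
  rw [this, div_mul_eq_mul_div, div_le_iff₀ (by positivity)]
  nlinarith

theorem unit_nonneg {n : ℕ} (y : Fin n → L) : 0 ≤ ∑ k, |y k| :=
  Finset.sum_nonneg fun _ _ => abs_nonneg _

theorem smul_mono {u : L} (hu : 0 ≤ u) {a b : ℝ} (h : a ≤ b) : a • u ≤ b • u := by
  have := smul_nonneg (sub_nonneg.2 h) hu
  rwa [sub_smul, sub_nonneg] at this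

theorem le_add_of_abs {n : ℕ} {y : Fin n → L} {p q} (hp : p ∈ graph y) (hq : q ∈ graph y)
    {ε : ℝ} (hε : 0 < ε) (h : ∀ t, p.1 t ≤ q.1 t + ε * ∑ k, |t k|) :
    p.2 ≤ q.2 + ε • ∑ k, |y k| :=
  le_of_le hp (add_mem hq (smul_mem hε (unit_mem y))) fun t => h t

theorem Approx.le {n : ℕ} {y : Fin n → L} {f g : (Fin n → ℝ) → ℝ} {z w : L}
    (hz : Approx y f z) (hw : Approx y g w) (hfg : f ≤ g) : z ≤ w := by
  rw [← sub_nonpos]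
  refine nonpos_of_smul (u := ∑ k, |y k|) fun ε hε => ?_
  obtain ⟨p, hp, h1, h2, -⟩ := hz (ε / 4) (by positivity)
  obtain ⟨q, hq, k1, -, k3⟩ := hw (ε / 4) (by positivity)
  have h : p.2 ≤ q.2 + (ε / 2) • ∑ k, |y k| := le_add_of_abs hp hq (by positivity) fun t => by
    have a1 := abs_le.1 (h1 t)
    have a2 := abs_le.1 (k1 t)
    have a3 := hfg t
    linarith [a1.1, a2.2]
  have e : ε = ε / 4 + ε / 2 + ε / 4 := by ring
  rw [sub_le_iff_le_add, e, add_smul, add_smul]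
  calc z ≤ p.2 + (ε / 4) • ∑ k, |y k| := h2
    _ ≤ q.2 + (ε / 2) • ∑ k, |y k| + (ε / 4) • ∑ k, |y k| := by gcongr
    _ ≤ w + (ε / 4) • ∑ k, |y k| + (ε / 2) • ∑ k, |y k| + (ε / 4) • ∑ k, |y k| := by gcongr
    _ = _ := by abel

theorem Approx.unique {n : ℕ} {y : Fin n → L} {f : (Fin n → ℝ) → ℝ} {z w : L}
    (hz : Approx y f z) (hw : Approx y f w) : z = w :=
  le_antisymm (hz.le hw le_rfl) (hw.le hz le_rfl)

theorem approx_of_mem {n : ℕ} {y : Fin n → L} {p} (hp : p ∈ graph y) : Approx y p.1 p.2 :=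
  fun ε hε => ⟨p, hp, fun t => by
      rw [sub_self, abs_zero]
      exact mul_nonneg hε.le (Finset.sum_nonneg fun _ _ => abs_nonneg _),
    le_add_of_nonneg_right (smul_nonneg hε.le (unit_nonneg y)),
    le_add_of_nonneg_right (smul_nonneg hε.le (unit_nonneg y))⟩

theorem Approx.add {n : ℕ} {y : Fin n → L} {f g : (Fin n → ℝ) → ℝ} {z w : L}
    (hz : Approx y f z) (hw : Approx y g w) : Approx y (f + g) (z + w) := by
  intro ε hε
  obtain ⟨p, hp, h1, h2, h3⟩ := hz (ε / 2) (by positivity)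
  obtain ⟨q, hq, k1, k2, k3⟩ := hw (ε / 2) (by positivity)
  have e : ε • ∑ k, |y k| = (ε / 2) • ∑ k, |y k| + (ε / 2) • ∑ k, |y k| := by
    rw [← add_smul, add_halves]
  refine ⟨p + q, add_mem hp hq, fun t => ?_, ?_, ?_⟩
  · have a1 := abs_le.1 (h1 t)
    have a2 := abs_le.1 (k1 t)
    change |f t + g t - (p.1 t + q.1 t)| ≤ _
    rw [abs_le]
    constructor <;> linarith [a1.1, a1.2, a2.1, a2.2]
  · rw [e]
    exact (add_le_add h2 k2).trans (le_of_eq (by change _ = p.2 + q.2 + _; abel))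
  · rw [e]
    exact (add_le_add h3 k3).trans (le_of_eq (by abel))

theorem Approx.neg {n : ℕ} {y : Fin n → L} {f : (Fin n → ℝ) → ℝ} {z : L}
    (hz : Approx y f z) : Approx y (-f) (-z) := by
  intro ε hε
  obtain ⟨p, hp, h1, h2, h3⟩ := hz ε hε
  refine ⟨-p, neg_mem hp, fun t => ?_, ?_, ?_⟩
  · change |-f t - -p.1 t| ≤ _
    rw [← abs_neg]
    convert h1 t using 2
    ring
  · change -z ≤ -p.2 + _
    rw [neg_le_iff_add_nonneg, ← sub_nonneg] at *
    convert h3 using 1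
    abel
  · change -p.2 ≤ -z + _
    rw [neg_le_iff_add_nonneg, ← sub_nonneg] at *
    convert h2 using 1
    abel

theorem Approx.smul_pos {n : ℕ} {y : Fin n → L} {f : (Fin n → ℝ) → ℝ} {z : L} {c : ℝ}
    (hc : 0 < c) (hz : Approx y f z) : Approx y (c • f) (c • z) := by
  intro ε hε
  obtain ⟨p, hp, h1, h2, h3⟩ := hz (ε / c) (by positivity)
  have e : ε • ∑ k, |y k| = c • (ε / c) • ∑ k, |y k| := by
    rw [smul_smul]; congr 1; field_simp
  refine ⟨c • p, smul_mem hc hp, fun t => ?_, ?_, ?_⟩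
  · change |c * f t - c * p.1 t| ≤ _
    rw [← mul_sub, abs_mul, abs_of_pos hc]
    calc c * |f t - p.1 t| ≤ c * (ε / c * ∑ k, |t k|) := mul_le_mul_of_nonneg_left (h1 t) hc.le
      _ = _ := by field_simp
  · rw [e]
    change c • z ≤ c • p.2 + _
    rw [← smul_add]
    exact smul_le_smul_of_nonneg_left h2 hc.le
  · rw [e, ← smul_add]
    exact smul_le_smul_of_nonneg_left h3 hc.le

theorem Approx.smul {n : ℕ} {y : Fin n → L} {f : (Fin n → ℝ) → ℝ} {z : L} (c : ℝ)
    (hz : Approx y f z) : Approx y (c • f) (c • z) := by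
  rcases lt_trichotomy c 0 with hc | rfl | hc
  · have := (hz.smul_pos (neg_pos.2 hc)).neg
    simpa using this
  · have := approx_of_mem (lin_mem y 0)
    simpa [Pi.zero_def] using this
  · exact hz.smul_pos hc

theorem Approx.sup {n : ℕ} {y : Fin n → L} {f g : (Fin n → ℝ) → ℝ} {z w : L}
    (hz : Approx y f z) (hw : Approx y g w) : Approx y (f ⊔ g) (z ⊔ w) := by
  intro ε hε
  obtain ⟨p, hp, h1, h2, h3⟩ := hz ε hε
  obtain ⟨q, hq, k1, k2, k3⟩ := hw ε hε
  refine ⟨p ⊔ q, sup_mem hp hq, fun t => ?_, ?_, ?_⟩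
  · change |max (f t) (g t) - max (p.1 t) (q.1 t)| ≤ _
    exact (abs_max_sub_max_le_max _ _ _ _).trans (max_le (h1 t) (k1 t))
  · change z ⊔ w ≤ (p.2 ⊔ q.2) + _
    rw [sup_add]
    exact sup_le_sup h2 k2
  · change p.2 ⊔ q.2 ≤ _
    rw [sup_add]
    exact sup_le_sup h3 k3

theorem exists_approx_value {n : ℕ} (y : Fin n → L) {f : (Fin n → ℝ) → ℝ} (hf : IsContHomog f) :
    ∃ z, Approx y f z := by
  set U : L := ∑ k, |y k| with hU
  have hU0 : 0 ≤ U := unit_nonneg y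
  have hN0 : 0 ≤ lnorm U := QuasiBanachSpace.qnorm_nonneg _
  have hδ : ∀ m : ℕ, (0 : ℝ) < 1 / ((m : ℝ) + 1) := fun m => by positivity
  choose p hp happ using fun m : ℕ => exists_approx y hf (hδ m)
  have hle : ∀ (n₀ m l : ℕ), n₀ ≤ m → n₀ ≤ l →
      (p m).2 ≤ (p l).2 + (2 * (1 / ((n₀ : ℝ) + 1))) • U := by
    intro n₀ m l hm hl
    refine le_add_of_abs (hp m) (hp l) (by positivity) fun t => ?_
    have a1 := abs_le.1 (happ m t)
    have a2 := abs_le.1 (happ l t)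
    have hs : 0 ≤ ∑ k, |t k| := Finset.sum_nonneg fun _ _ => abs_nonneg _
    have b1 := mul_le_mul_of_nonneg_right (Nat.one_div_le_one_div (α := ℝ) hm) hs
    have b2 := mul_le_mul_of_nonneg_right (Nat.one_div_le_one_div (α := ℝ) hl) hs
    linarith [a1.1, a2.2]
  have habs : ∀ (n₀ m l : ℕ), n₀ ≤ m → n₀ ≤ l →
      lnorm ((p m).2 - (p l).2) ≤ 2 * (1 / ((n₀ : ℝ) + 1)) * lnorm U := by
    intro n₀ m l hm hl
    have h1 : |(p m).2 - (p l).2| ≤ |(2 * (1 / ((n₀ : ℝ) + 1))) • U| := by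
      rw [abs_of_nonneg (smul_nonneg (by positivity) hU0)]
      refine sup_le (sub_le_iff_le_add'.2 (hle n₀ m l hm hl)) ?_
      rw [neg_sub]
      exact sub_le_iff_le_add'.2 (hle n₀ l m hl hm)
    refine (QuasiBanachLattice.qnorm_solid _ _ h1).trans (le_of_eq ?_)
    rw [QuasiBanachSpace.qnorm_smul, Real.norm_of_nonneg (by positivity)]
  have hsmall : ∀ ε : ℝ, 0 < ε → ∃ n₀ : ℕ, 2 * (1 / ((n₀ : ℝ) + 1)) * lnorm U < ε := by
    intro ε hε
    obtain ⟨n₀, hn₀⟩ := exists_nat_one_div_lt (show 0 < ε / (2 * (lnorm U + 1)) by positivity)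
    refine ⟨n₀, ?_⟩
    rw [lt_div_iff₀ (by positivity)] at hn₀
    nlinarith [hδ n₀]
  obtain ⟨z, hz⟩ := QuasiBanachSpace.complete (𝕜 := ℝ) (fun m => (p m).2) (by
    intro ε hε
    obtain ⟨n₀, hn₀⟩ := hsmall ε hε
    exact ⟨n₀, fun m hm l hl => (habs n₀ m l hm hl).trans_lt hn₀⟩)
  have hlim : ∀ ε : ℝ, 0 < ε → ∀ n₀ : ℕ, ∃ m, n₀ ≤ m ∧ lnorm ((p m).2 - z) ≤ ε ∧
      lnorm (z - (p m).2) ≤ ε := by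
    intro ε hε n₀
    obtain ⟨m, hm, hmn⟩ := ((hz.eventually_lt_const hε).and (eventually_ge_atTop n₀)).exists
    refine ⟨m, hmn, hm.le, (QuasiBanachLattice.qnorm_solid _ _ ?_).trans hm.le⟩
    rw [abs_sub_comm]
  refine ⟨z, fun ε hε => ?_⟩
  obtain ⟨n₀, hn₀⟩ := exists_nat_one_div_lt (show 0 < ε / 2 by positivity)
  have h2 : (2 * (1 / ((n₀ : ℝ) + 1))) • U ≤ ε • U := smul_mono hU0 (by linarith)
  refine ⟨p n₀, hp n₀, fun t => (happ n₀ t).trans ?_, ?_, ?_⟩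
  · exact mul_le_mul_of_nonneg_right (by linarith)
      (Finset.sum_nonneg fun _ _ => abs_nonneg _)
  · refine le_trans ?_ (add_le_add_right h2 _)
    rw [← sub_nonpos]
    refine nonpos_of_lnorm fun η hη => ?_
    obtain ⟨m, hm, -, hd⟩ := hlim η hη n₀
    refine ⟨_, ?_, hd⟩
    exact sub_le_sub_left (hle n₀ m n₀ hm le_rfl) z
  · refine le_trans ?_ (add_le_add_right h2 _)
    rw [← sub_nonpos]
    refine nonpos_of_lnorm fun η hη => ?_
    obtain ⟨m, hm, hd, -⟩ := hlim η hη n₀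
    refine ⟨_, ?_, hd⟩
    have := hle n₀ n₀ m le_rfl hm
    rw [sub_le_iff_le_add]
    refine this.trans (le_of_eq ?_)
    abel

/-- Every tuple in a quasi-Banach lattice admits a Krivine functional calculus. -/
theorem exists_calculus {n : ℕ} (y : Fin n → L) : ∃ Φ, IsKrivineCalculus y Φ := by
  classical
  let Φ : ((Fin n → ℝ) → ℝ) → L := fun f =>
    if h : IsContHomog f then (exists_approx_value y h).choose else 0
  have hΦ : ∀ f, IsContHomog f → Approx y f (Φ f) := fun f hf => by
    simp only [Φ, dif_pos hf]
    exact (exists_approx_value y hf).choose_spec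
  have hΦ' : ∀ f z, IsContHomog f → Approx y f z → Φ f = z := fun f z hf hz =>
    (hΦ f hf).unique hz
  refine ⟨Φ, fun k => ?_, fun f g hf hg => ?_, fun c f hf => ?_, fun f g hf hg => ?_⟩
  · exact hΦ' _ _ (isContHomog (coord_mem y k)) (approx_of_mem (coord_mem y k))
  · refine hΦ' _ _ ⟨hf.1.add hg.1, fun c t hc => ?_⟩ ((hΦ f hf).add (hΦ g hg))
    simp only [Pi.add_apply, hf.2 c t hc, hg.2 c t hc]; ring
  · refine hΦ' _ _ ⟨hf.1.const_smul c, fun a t ha => ?_⟩ ((hΦ f hf).smul c)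
    simp only [Pi.smul_apply, smul_eq_mul, hf.2 a t ha]; ring
  · refine hΦ' _ _ ⟨hf.1.sup hg.1, fun c t hc => ?_⟩ ((hΦ f hf).sup (hΦ g hg))
    change max (f (c • t)) (g (c • t)) = c * max (f t) (g t)
    rw [hf.2 c t hc, hg.2 c t hc, mul_max_of_nonneg _ _ hc]

/-- The Krivine functional calculus is unique. -/
theorem calculus_unique {n : ℕ} {y : Fin n → L} {Φ Ψ : ((Fin n → ℝ) → ℝ) → L}
    (hΦ : IsKrivineCalculus y Φ) (hΨ : IsKrivineCalculus y Ψ) {f : (Fin n → ℝ) → ℝ}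
    (hf : IsContHomog f) : Φ f = Ψ f := by
  have key : ∀ Φ : ((Fin n → ℝ) → ℝ) → L, IsKrivineCalculus y Φ → Approx y f (Φ f) := by
    intro Φ hΦ
    have hcoord : ∀ k : Fin n, IsContHomog fun t : Fin n → ℝ => t k :=
      fun k => isContHomog (coord_mem y k)
    have hsm : ∀ (c : ℝ) f, IsContHomog (n := n) f → IsContHomog (c • f) := fun c f hf =>
      ⟨hf.1.const_smul c, fun a t ha => by
        simp only [Pi.smul_apply, smul_eq_mul, hf.2 a t ha]; ring⟩
    have had : ∀ f g, IsContHomog (n := n) f → IsContHomog g → IsContHomog (f + g) :=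
      fun f g hf hg => ⟨hf.1.add hg.1, fun c t hc => by
        simp only [Pi.add_apply, hf.2 c t hc, hg.2 c t hc]; ring⟩
    have hlin : ∀ (a : Fin n → ℝ) (s : Finset (Fin n)),
        IsContHomog (fun t : Fin n → ℝ => ∑ k ∈ s, a k * t k) ∧
          Φ (fun t => ∑ k ∈ s, a k * t k) = ∑ k ∈ s, a k • y k := by
      intro a s
      induction s using Finset.induction_on with
      | empty =>
        have h0 : IsContHomog fun t : Fin n → ℝ => (0 : ℝ) :=
          ⟨continuous_const, fun c t _ => by simp⟩
        have := hΦ.smul 0 _ h0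
        rw [zero_smul, zero_smul] at this
        simp only [Finset.sum_empty]
        exact ⟨h0, this⟩
      | insert k s hk ih =>
        have e : (fun t : Fin n → ℝ => ∑ j ∈ insert k s, a j * t j) =
            (a k • fun t : Fin n → ℝ => t k) + fun t => ∑ j ∈ s, a j * t j := by
          funext t
          simp [Finset.sum_insert hk]
        rw [e]
        refine ⟨had _ _ (hsm _ _ (hcoord k)) ih.1, ?_⟩
        rw [hΦ.add _ _ (hsm _ _ (hcoord k)) ih.1, hΦ.smul _ _ (hcoord k), hΦ.coord, ih.2,
          Finset.sum_insert hk]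
    have hgraph : ∀ p ∈ graph y, Φ p.1 = p.2 := by
      intro p hp
      suffices h : p ∈ {p : ((Fin n → ℝ) → ℝ) × L | p ∈ graph y ∧ Φ p.1 = p.2} from h.2
      refine latticeClosure_min ?_ ⟨?_, ?_⟩ hp
      · rintro _ ⟨a, rfl⟩
        exact ⟨lin_mem y a, (hlin a Finset.univ).2⟩
      · rintro p ⟨hp, hp'⟩ q ⟨hq, hq'⟩
        refine ⟨sup_mem hp hq, ?_⟩
        change Φ (p.1 ⊔ q.1) = p.2 ⊔ q.2
        rw [hΦ.sup _ _ (isContHomog hp) (isContHomog hq), hp', hq']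
      · rintro p ⟨hp, hp'⟩ q ⟨hq, hq'⟩
        refine ⟨inf_mem hp hq, ?_⟩
        change Φ (p.1 ⊓ q.1) = p.2 ⊓ q.2
        have e : p.1 ⊓ q.1 = (-1 : ℝ) • ((-1 : ℝ) • p.1 ⊔ (-1 : ℝ) • q.1) := by
          simp only [neg_smul, one_smul, neg_sup, neg_neg]
        have hp1 := hsm (-1) _ (isContHomog hp)
        have hq1 := hsm (-1) _ (isContHomog hq)
        have hpq := (isContHomog (sup_mem (neg_mem hp) (neg_mem hq)))
        have e' : (-1 : ℝ) • p.1 ⊔ (-1 : ℝ) • q.1 = (-p ⊔ -q).1 := by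
          simp only [neg_smul, one_smul]; rfl
        rw [e, hΦ.smul _ _ (by rw [e']; exact hpq), hΦ.sup _ _ hp1 hq1,
          hΦ.smul _ _ (isContHomog hp), hΦ.smul _ _ (isContHomog hq), hp', hq']
        simp only [neg_smul, one_smul, neg_sup, neg_neg]
    have hmono : ∀ f g, IsContHomog f → IsContHomog g → f ≤ g → Φ f ≤ Φ g := by
      intro f g hf hg hfg
      have := hΦ.sup f g hf hg
      rw [sup_eq_right.2 hfg] at this
      rw [this]
      exact le_sup_left
    intro ε hε
    obtain ⟨p, hp, happ⟩ := exists_approx y hf hε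
    have hu := smul_mem hε (unit_mem y)
    have hpu := hgraph _ (add_mem hp hu)
    have hfu : Φ (f + (ε • ((fun t : Fin n → ℝ => ∑ k, |t k|), ∑ k, |y k|) :
        ((Fin n → ℝ) → ℝ) × L).1) = Φ f + ε • ∑ k, |y k| := by
      rw [hΦ.add _ _ hf (isContHomog hu), hgraph _ hu]
      rfl
    refine ⟨p, hp, happ, ?_, ?_⟩
    · refine (hmono _ _ hf (isContHomog (add_mem hp hu)) fun t => ?_).trans (le_of_eq hpu)
      have := (abs_le.1 (happ t)).2
      change f t ≤ p.1 t + ε * ∑ k, |t k|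
      linarith
    · rw [← hfu, ← hgraph p hp]
      refine hmono _ _ (isContHomog hp) (had _ _ hf (isContHomog hu)) fun t => ?_
      have := (abs_le.1 (happ t)).1
      change p.1 t ≤ f t + ε * ∑ k, |t k|
      linarith
  exact (key Φ hΦ).unique (key Ψ hΨ)

end Krivine

/-- The element `f(y₁, …, yₙ)` of a quasi-Banach lattice, for `f` continuous and positively
homogeneous, given by the (existing and unique) Krivine functional calculus. -/
noncomputable def krivine {L : Type*} [AddCommGroup L] [Module ℝ L] [Lattice L]
    [QuasiBanachLattice L] {n : ℕ} (f : (Fin n → ℝ) → ℝ) (y : Fin n → L) : L :=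
  (Krivine.exists_calculus y).choose f

/-! ### Complex quasi-Banach lattices and natural spaces -/

/-- The complexification `L ⊕ iL` of a real vector space `L`; the pair `(x, y)` is `x + iy`.
The complex quasi-Banach lattices are the complexifications of the real ones. -/
def Complexification (L : Type*) : Type _ := L × L

namespace Complexification

variable {L : Type*} [AddCommGroup L] [Module ℝ L]

/-- real part -/
def re (z : Complexification L) : L := z.1

/-- imaginary part -/
def im (z : Complexification L) : L := z.2

instance : AddCommGroup (Complexification L) := inferInstanceAs (AddCommGroup (L × L))

instance : SMul ℂ (Complexification L) :=
  ⟨fun c z => (c.re • z.re - c.im • z.im, c.re • z.im + c.im • z.re)⟩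

instance : Module ℂ (Complexification L) where
  one_smul z := Prod.ext (by change (1 : ℂ).re • z.re - (1 : ℂ).im • z.im = z.re; simp)
    (by change (1 : ℂ).re • z.im + (1 : ℂ).im • z.re = z.im; simp)
  mul_smul a b z := Prod.ext
    (by
      change (a * b).re • z.re - (a * b).im • z.im =
        a.re • (b.re • z.re - b.im • z.im) - a.im • (b.re • z.im + b.im • z.re)
      rw [Complex.mul_re, Complex.mul_im]; module)
    (by
      change (a * b).re • z.im + (a * b).im • z.re =
        a.re • (b.re • z.im + b.im • z.re) + a.im • (b.re • z.re - b.im • z.im)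
      rw [Complex.mul_re, Complex.mul_im]; module)
  smul_zero a := Prod.ext (by change a.re • (0 : L) - a.im • (0 : L) = 0; simp)
    (by change a.re • (0 : L) + a.im • (0 : L) = 0; simp)
  smul_add a z w := Prod.ext
    (by
      change a.re • (z.re + w.re) - a.im • (z.im + w.im) =
        (a.re • z.re - a.im • z.im) + (a.re • w.re - a.im • w.im)
      module)
    (by
      change a.re • (z.im + w.im) + a.im • (z.re + w.re) =
        (a.re • z.im + a.im • z.re) + (a.re • w.im + a.im • w.re)
      module)
  add_smul a b z := Prod.ext
    (by
      change (a + b).re • z.re - (a + b).im • z.im =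
        (a.re • z.re - a.im • z.im) + (b.re • z.re - b.im • z.im)
      rw [Complex.add_re, Complex.add_im]; module)
    (by
      change (a + b).re • z.im + (a + b).im • z.re =
        (a.re • z.im + a.im • z.re) + (b.re • z.im + b.im • z.re)
      rw [Complex.add_re, Complex.add_im]; module)
  zero_smul z := Prod.ext (by change (0 : ℂ).re • z.re - (0 : ℂ).im • z.im = 0; simp)
    (by change (0 : ℂ).re • z.im + (0 : ℂ).im • z.re = 0; simp)

variable [Lattice L] [QuasiBanachLattice L]

/-- The modulus `|x + iy| = (x² + y²)^{1/2}`, an element of `L`. -/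
noncomputable def modulus (z : Complexification L) : L :=
  krivine (fun t : Fin 2 → ℝ => Real.sqrt (t 0 ^ 2 + t 1 ^ 2)) ![z.re, z.im]

/-- The quasinorm `‖z‖ = ‖ |z| ‖` of the complex quasi-Banach lattice `L ⊕ iL`. -/
noncomputable def cnorm (z : Complexification L) : ℝ := lnorm z.modulus

end Complexification

/-- `q`-convexity of the complex quasi-Banach lattice `Y = L ⊕ iL`:
`‖(∑ |y_k|^q)^{1/q}‖ ≤ C (∑ ‖y_k‖^q)^{1/q}` for all `y₁, …, yₙ ∈ Y`. -/
def IsQConvex (q : ℝ) (L : Type*) [AddCommGroup L] [Module ℝ L] [Lattice L]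
    [QuasiBanachLattice L] : Prop :=
  ∃ C : ℝ, ∀ (n : ℕ) (y : Fin n → Complexification L),
    lnorm (krivine (fun t : Fin n → ℝ => (∑ k, |t k| ^ q) ^ (1 / q)) fun k => (y k).modulus) ≤
      C * (∑ k, (y k).cnorm ^ q) ^ (1 / q)

universe u v

/-- A complex quasi-Banach space is natural if it is linearly isomorphic to a closed linear
subspace of a complex quasi-Banach lattice that is `q`-convex for some `q > 0`.  (As `X` is
complete, the range of an isomorphic embedding `T` is automatically closed.) -/
def IsNatural (X : Type u) [AddCommGroup X] [Module ℂ X] [QuasiBanachSpace ℂ X] : Prop :=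
  ∃ (L : Type v) (_ : AddCommGroup L) (_ : Module ℝ L) (_ : Lattice L) (_ : QuasiBanachLattice L),
    (∃ q : ℝ, 0 < q ∧ IsQConvex q L) ∧
    ∃ (T : X →ₗ[ℂ] Complexification L) (a b : ℝ), 0 < a ∧ 0 < b ∧
      ∀ x : X, a * QuasiBanachSpace.qnorm ℂ x ≤ (T x).cnorm ∧
        (T x).cnorm ≤ b * QuasiBanachSpace.qnorm ℂ x

/-! ### Sidon sets and property `𝒞_p(X)` -/

/-- The normalized Haar measure of a compact group. -/
noncomputable def haarProb (G : Type*) [Group G] [TopologicalSpace G] [IsTopologicalGroup G]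
    [CompactSpace G] [MeasurableSpace G] [BorelSpace G] : Measure G :=
  Measure.haarMeasure (⊤ : TopologicalSpace.PositiveCompacts G)

/-- The `L_p`-quasinorm, `0 < p ≤ ∞`, of an `X`-valued function on a compact group. -/
noncomputable def lpQNorm {G X : Type*} [Group G] [TopologicalSpace G] [IsTopologicalGroup G]
    [CompactSpace G] [MeasurableSpace G] [BorelSpace G] [AddCommGroup X] [Module ℂ X]
    [QuasiBanachSpace ℂ X] (p : ℝ≥0∞) (φ : G → X) : ℝ≥0∞ :=
  eLpNorm (fun g => QuasiBanachSpace.qnorm ℂ (φ g)) p (haarProb G)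

/-- The Cantor group `{±1}^ℕ`. -/
abbrev CantorGroup : Type := ℕ → ℤˣ

instance : DiscreteMeasurableSpace ℤˣ where
  forall_measurableSet s := ⟨Units.val '' s, MeasurableSet.of_discrete,
    Set.preimage_image_eq s Units.val_injective⟩

/-- The coordinate functions `ε_n` on the Cantor group. -/
def rademacher (n : ℕ) (t : CantorGroup) : ℂ := ((t n : ℤ) : ℂ)

/-- Sidon sets in the dual of a compact abelian group. -/
def IsSidon {G : Type*} [CommGroup G] [TopologicalSpace G] (E : Set (PontryaginDual G)) : Prop :=
  ∃ M : ℝ, ∀ (s : Finset (PontryaginDual G)) (a : PontryaginDual G → ℂ), ↑s ⊆ E →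
    ∑ γ ∈ s, ‖a γ‖ ≤ M * ⨆ g : G, ‖∑ γ ∈ s, a γ * ((γ g : Circle) : ℂ)‖

/-- Property `𝒞_p(X)` of a set `E` of characters: with a constant `M` that depends only on `E`,
`X` and `p`, `M⁻¹ ‖∑ x_k ε_k‖_p ≤ ‖∑ x_k γ_k‖_p ≤ M ‖∑ x_k ε_k‖_p` for all finite subsets
`{γ₁, …, γₙ}` of `E` and all `x₁, …, xₙ ∈ X`. -/
def HasPropertyC {G : Type*} [CommGroup G] [TopologicalSpace G] [IsTopologicalGroup G]
    [CompactSpace G] [MeasurableSpace G] [BorelSpace G] (p : ℝ≥0∞) (X : Type*) [AddCommGroup X]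
    [Module ℂ X] [QuasiBanachSpace ℂ X] (E : Set (PontryaginDual G)) : Prop :=
  ∃ M : ℝ≥0, 0 < M ∧ ∀ (n : ℕ) (γ : Fin n → PontryaginDual G) (x : Fin n → X),
    Function.Injective γ → (∀ k, γ k ∈ E) →
      (M : ℝ≥0∞)⁻¹ * lpQNorm p (fun t : CantorGroup => ∑ k : Fin n, rademacher k t • x k) ≤
          lpQNorm p (fun g : G => ∑ k, ((γ k g : Circle) : ℂ) • x k) ∧
        lpQNorm p (fun g : G => ∑ k, ((γ k g : Circle) : ℂ) • x k) ≤
          M * lpQNorm p (fun t : CantorGroup => ∑ k : Fin n, rademacher k t • x k)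

/-!
# Sidon sets and vector-valued sums of characters in natural spaces

For a Banach space and `p ≥ 1` one convolves with a measure of bounded norm that changes the
signs of the characters. In a quasi-Banach space integrals against measures are not bounded, and
the lattice structure replaces them.

*Reduction to homogeneous functions.* After embedding `X` in a `q`-convex lattice, every quantity in
the theorem for given `x₁, …, xₙ` has the form `ρ(|∑ a_k t_k|)`, where `ρ` is a monotone homogeneous
functional on nonnegative homogeneous functions on `ℂⁿ` with `ρ((∑ Hᵢ^q)^{1/q})^q ≤ K ∑ ρ(Hᵢ)^q`
(`IsConvexGauge`). Such a gauge is obtained by evaluating `H` at the `x_k` with Krivine's calculus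
(`isConvexGauge_krivineGauge`) and then taking the `L_p` average over the orbit of the characters
(`isConvexGauge_lpGauge`). A `q`-convex gauge is `s`-convex for `s ≤ q`
(`IsConvexGauge.of_le`), so one may assume `q ≤ min 1 p`.

*The main estimate.* Write `T a = ∑ a_k t_k` for `a ∈ ℓ_∞ⁿ`, and `N = sup ρ(|T a|)` over the unit
ball. A truncation argument with random signs gives a Grothendieck inequality
`ρ((∑ |T aᵢ|²)^{1/2}) ≤ C N max_k (∑ᵢ |aᵢ(k)|²)^{1/2}` (`exists_gaugeSqNorm_le`). Now let the unit
ball lie in the closed convex hull of `M B` for a circled set `B` in the ball on which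
`ρ(|T b|) ≤ D`. If `a = ∑ cᵢ bᵢ` with `∑ |cᵢ| ≤ M`, then `∑ |cᵢ| |T bᵢ|` is bounded by a large
multiple of `(∑ |cᵢ| |T bᵢ|^q)^{1/q}`, which convexity bounds in terms of `D`, plus a small multiple
of `(∑ |cᵢ| |T bᵢ|²)^{1/2}`, which the Grothendieck inequality bounds by a multiple of `N`.
The latter term is absorbed, so `N ≤ C D` (`exists_gaugeNorm_le`).

*Conclusion.* The Sidon property says, by duality, that `B = {z (γ_k(g))_k : |z| = 1, g ∈ G}` has
the required convex hull (`mem_closure_convexHull_of_sidon`), and translation invariance makes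
`ρ(|T b|)` constant on `B`. Hence `‖∑ a_k γ_k x_k‖_p ≤ C ‖∑ γ_k x_k‖_p` whenever `|a_k| ≤ 1`
(`exists_multiplier_bound`). The same holds for the Rademacher functions, which form a Sidon set,
and the two systems are compared through the sums `∑ γ_k(g) ε_k(t) x_k` on `G × Δ`
(`lpQNorm_le_of_multiplier_bound`).
-/

/-! ### Khinchin's inequality for random signs -/

theorem sum_signs_succ {m : ℕ} (f : (Fin (m + 1) → ℤˣ) → ℝ) :
    ∑ r, f r = ∑ r : Fin m → ℤˣ, (f (Fin.cons 1 r) + f (Fin.cons (-1) r)) := by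
  rw [← (Fin.consEquiv fun _ : Fin (m + 1) => ℤˣ).sum_comp, Fintype.sum_prod_type,
    Finset.sum_comm]
  refine Finset.sum_congr rfl fun r _ => ?_
  rw [UnitsInt.univ, Finset.sum_pair (by decide)]
  rfl

/-- The random sum `∑ rᵢ sᵢ`. -/
def signSum {m : ℕ} (s : Fin m → ℂ) (r : Fin m → ℤˣ) : ℂ := ∑ i, ((r i : ℤ) : ℂ) * s i

theorem signSum_cons {m : ℕ} (s : Fin (m + 1) → ℂ) (e : ℤˣ) (r : Fin m → ℤˣ) :
    signSum s (Fin.cons e r) = ((e : ℤ) : ℂ) * s 0 + signSum (Fin.tail s) r := by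
  simp [signSum, Fin.sum_univ_succ, Fin.tail]

theorem sum_norm_signSum_sq {m : ℕ} (s : Fin m → ℂ) :
    ∑ r, ‖signSum s r‖ ^ 2 = 2 ^ m * ∑ i, ‖s i‖ ^ 2 := by
  induction m with
  | zero => simp [signSum]
  | succ m ih =>
    have h : ∀ a b : ℂ, ‖a + b‖ ^ 2 + ‖-a + b‖ ^ 2 = 2 * ‖b‖ ^ 2 + 2 * ‖a‖ ^ 2 := by
      intro a b
      have := parallelogram_law_with_norm ℂ b a
      rw [add_comm a b, neg_add_eq_sub]
      nlinarith
    simp only [sum_signs_succ, signSum_cons, Units.val_one, Int.cast_one, one_mul, Units.val_neg,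
      Int.cast_neg, neg_mul, h, Finset.sum_add_distrib, ← Finset.mul_sum, ih, Fin.sum_univ_succ]
    simp [Fin.tail]
    ring

theorem sum_norm_signSum_pow_four {m : ℕ} (s : Fin m → ℂ) :
    ∑ r, ‖signSum s r‖ ^ 4 ≤ 2 ^ m * (3 * (∑ i, ‖s i‖ ^ 2) ^ 2) := by
  induction m with
  | zero => simp [signSum]
  | succ m ih =>
    have h : ∀ a b : ℂ, ‖a + b‖ ^ 4 + ‖-a + b‖ ^ 4 ≤
        2 * ‖b‖ ^ 4 + 12 * ‖a‖ ^ 2 * ‖b‖ ^ 2 + 2 * ‖a‖ ^ 4 := by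
      intro a b
      have h1 := norm_add_sq_real a b
      have h2 := norm_add_sq_real (-a) b
      have h3 := abs_real_inner_le_norm a b
      rw [inner_neg_left, norm_neg] at h2
      have h4 : (inner ℝ a b) ^ 2 ≤ (‖a‖ * ‖b‖) ^ 2 := sq_le_sq' (abs_le.1 h3).1 (abs_le.1 h3).2
      have e1 : ‖a + b‖ ^ 4 = (‖a + b‖ ^ 2) ^ 2 := by ring
      have e2 : ‖-a + b‖ ^ 4 = (‖-a + b‖ ^ 2) ^ 2 := by ring
      rw [e1, e2, h1, h2]
      nlinarith
    simp only [sum_signs_succ, signSum_cons, Units.val_one, Int.cast_one, one_mul, Units.val_neg,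
      Int.cast_neg, neg_mul]
    refine (Finset.sum_le_sum fun r _ => h _ _).trans ?_
    have h2 := sum_norm_signSum_sq (Fin.tail s)
    have h4 := ih (Fin.tail s)
    simp only [Finset.sum_add_distrib, ← Finset.mul_sum, h2, Fin.sum_univ_succ]
    have e : ∑ i, ‖Fin.tail s i‖ ^ 2 = ∑ i : Fin m, ‖s i.succ‖ ^ 2 := rfl
    rw [e] at h2 h4
    rw [e]
    simp only [Finset.sum_const, Finset.card_univ, Fintype.card_fun, Fintype.card_units_int,
      Fintype.card_fin, nsmul_eq_mul]
    push_cast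
    have : (0 : ℝ) ≤ 2 ^ m * ‖s 0‖ ^ 4 := by positivity
    rw [pow_succ (2 : ℝ) m]
    nlinarith

/-- Khinchin's inequality, for complex coefficients and exponents in `(0, 1]`. -/
theorem khinchin {m : ℕ} (s : Fin m → ℂ) {q : ℝ} (hq : 0 < q) (hq1 : q ≤ 1) :
    2 ^ m * √(∑ i, ‖s i‖ ^ 2) ^ q ≤ 12 * ∑ r, ‖signSum s r‖ ^ q := by
  set σ := √(∑ i, ‖s i‖ ^ 2) with hσ
  have hsq : σ ^ 2 = ∑ i, ‖s i‖ ^ 2 := Real.sq_sqrt (by positivity)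
  rcases (Real.sqrt_nonneg (∑ i, ‖s i‖ ^ 2)).eq_or_lt with h0 | h0
  · rw [← hσ] at h0
    rw [← h0, Real.zero_rpow hq.ne', mul_zero]
    positivity
  rw [← hσ] at h0
  -- Above `√6 σ` the square is dominated by the fourth power, below it by the `q`-th power.
  have key : ∀ x : ℝ, 0 ≤ x → x ^ 2 ≤ 6 * (σ ^ (2 - q) * x ^ q) + x ^ 4 / (6 * σ ^ 2) := by
    intro x hx
    have hσq : 0 < σ ^ (2 - q) := Real.rpow_pos_of_pos h0 _
    have hxq : 0 ≤ x ^ q := Real.rpow_nonneg hx _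
    rcases le_total (x ^ 2) (6 * σ ^ 2) with h | h
    · rcases hx.eq_or_lt with rfl | hx0
      · rw [Real.zero_rpow hq.ne']
        simp
      have h6 : x ≤ √6 * σ := by
        rw [← Real.sqrt_sq hx, ← Real.sqrt_sq h0.le, ← Real.sqrt_mul (by norm_num)]
        exact Real.sqrt_le_sqrt h
      have e : x ^ 2 = x ^ (2 - q) * x ^ q := by
        rw [← Real.rpow_add hx0, sub_add_cancel, Real.rpow_two]
      have h7 : x ^ (2 - q) ≤ 6 * σ ^ (2 - q) := by
        refine (Real.rpow_le_rpow hx h6 (by linarith)).trans ?_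
        rw [Real.mul_rpow (by positivity) h0.le]
        refine mul_le_mul_of_nonneg_right ?_ hσq.le
        have h8 : (1 : ℝ) ≤ √6 := Real.one_le_sqrt.2 (by norm_num)
        refine (Real.rpow_le_rpow_of_exponent_le h8 (show 2 - q ≤ 2 by linarith)).trans ?_
        rw [Real.rpow_two, Real.sq_sqrt (by norm_num)]
      have : 0 ≤ x ^ 4 / (6 * σ ^ 2) := by positivity
      rw [e]
      nlinarith [mul_le_mul_of_nonneg_right h7 hxq]
    · have : x ^ 2 ≤ x ^ 4 / (6 * σ ^ 2) := by
        rw [le_div_iff₀ (by positivity)]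
        nlinarith [sq_nonneg x]
      have : 0 ≤ σ ^ (2 - q) * x ^ q := by positivity
      linarith
  have h2 := sum_norm_signSum_sq s
  have h4 := sum_norm_signSum_pow_four s
  have hsum := Finset.sum_le_sum fun (r : Fin m → ℤˣ) (_ : r ∈ Finset.univ) =>
    key ‖signSum s r‖ (norm_nonneg _)
  rw [h2, Finset.sum_add_distrib, ← Finset.mul_sum, ← Finset.mul_sum, ← Finset.sum_div] at hsum
  rw [← hsq] at hsum h4
  have h5 : (∑ r, ‖signSum s r‖ ^ 4) / (6 * σ ^ 2) ≤ 2 ^ m * σ ^ 2 / 2 := by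
    rw [div_le_iff₀ (by positivity)]
    refine h4.trans (le_of_eq ?_)
    ring
  have e : σ ^ 2 = σ ^ (2 - q) * σ ^ q := by
    rw [← Real.rpow_add h0, sub_add_cancel, Real.rpow_two]
  have hσq : 0 < σ ^ (2 - q) := Real.rpow_pos_of_pos h0 _
  rw [e] at hsum h5
  refine le_of_mul_le_mul_left ?_ hσq
  nlinarith

/-! ### Convex gauges on homogeneous functions -/

/-- Nonnegative continuous functions that are positively homogeneous of degree one. -/
structure IsNonnegHomog {V : Type*} [TopologicalSpace V] [AddCommGroup V] [Module ℝ V]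
    (H : V → ℝ) : Prop where
  cont : Continuous H
  nonneg : ∀ t, 0 ≤ H t
  homog : ∀ (c : ℝ) t, 0 ≤ c → H (c • t) = c * H t

/-- A `q`-convex gauge with constant `K`: a monotone, positively homogeneous functional `ρ` on the
nonnegative homogeneous functions with `ρ((∑ Hᵢ^q)^{1/q})^q ≤ K ∑ ρ(Hᵢ)^q`.  The last condition is
stated for all `H₀ ≤ (∑ Hᵢ^q)^{1/q}`; the values of `ρ` at other functions are irrelevant. -/
structure IsConvexGauge {V : Type*} [TopologicalSpace V] [AddCommGroup V] [Module ℝ V]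
    (q K : ℝ) (ρ : (V → ℝ) → ℝ) : Prop where
  nonneg : ∀ H, 0 ≤ ρ H
  mono : ∀ H₁ H₂, IsNonnegHomog H₁ → IsNonnegHomog H₂ → (∀ t, H₁ t ≤ H₂ t) → ρ H₁ ≤ ρ H₂
  smul : ∀ (c : ℝ) H, 0 ≤ c → IsNonnegHomog H → ρ (fun t => c * H t) = c * ρ H
  conv : ∀ (m : ℕ) (H₀ : V → ℝ) (H : Fin m → V → ℝ), IsNonnegHomog H₀ →
    (∀ i, IsNonnegHomog (H i)) → (∀ t, H₀ t ^ q ≤ ∑ i, H i t ^ q) →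
      ρ H₀ ^ q ≤ K * ∑ i, ρ (H i) ^ q

section

variable {V : Type*} [TopologicalSpace V] [AddCommGroup V] [Module ℝ V]

theorem IsNonnegHomog.const_mul {H : V → ℝ} (hH : IsNonnegHomog H) {c : ℝ} (hc : 0 ≤ c) :
    IsNonnegHomog fun t => c * H t :=
  ⟨hH.cont.const_mul c, fun t => mul_nonneg hc (hH.nonneg t), fun a t ha => by
    rw [hH.homog a t ha]; ring⟩

theorem IsNonnegHomog.sum_rpow {ι : Type*} [Fintype ι] {H : ι → V → ℝ}
    (hH : ∀ i, IsNonnegHomog (H i)) {q : ℝ} (hq : 0 < q) :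
    IsNonnegHomog fun t => (∑ i, H i t ^ q) ^ (1 / q) := by
  refine ⟨?_, fun t => ?_, fun c t hc => ?_⟩
  · refine Continuous.rpow_const ?_ fun _ => Or.inr (by positivity)
    exact continuous_finsetSum _ fun i _ => (hH i).cont.rpow_const fun _ => Or.inr hq.le
  · exact Real.rpow_nonneg (Finset.sum_nonneg fun i _ => Real.rpow_nonneg ((hH i).nonneg t) _) _
  · have h : ∀ i, H i (c • t) ^ q = c ^ q * H i t ^ q := fun i => by
      rw [(hH i).homog c t hc, Real.mul_rpow hc ((hH i).nonneg t)]
    simp only [h, ← Finset.mul_sum]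
    rw [Real.mul_rpow (Real.rpow_nonneg hc _)
      (Finset.sum_nonneg fun i _ => Real.rpow_nonneg ((hH i).nonneg t) _), ← Real.rpow_mul hc,
      mul_one_div_cancel hq.ne', Real.rpow_one]

/-- Weighted form of `q`-convexity, over an arbitrary finite index type. -/
theorem IsConvexGauge.rpow_le {q K : ℝ} {ρ : (V → ℝ) → ℝ} (hρ : IsConvexGauge q K ρ) (hq : 0 < q)
    {ι : Type*} [Fintype ι] {H₀ : V → ℝ} {H : ι → V → ℝ} {w : ι → ℝ} (hw : ∀ i, 0 ≤ w i)
    (h₀ : IsNonnegHomog H₀) (hH : ∀ i, IsNonnegHomog (H i))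
    (h : ∀ t, H₀ t ^ q ≤ ∑ i, w i * H i t ^ q) :
    ρ H₀ ^ q ≤ K * ∑ i, w i * ρ (H i) ^ q := by
  have hwi : ∀ i, 0 ≤ w i ^ (1 / q) := fun i => Real.rpow_nonneg (hw i) _
  have e : ∀ i (x : ℝ), 0 ≤ x → (w i ^ (1 / q) * x) ^ q = w i * x ^ q := fun i x hx => by
    rw [Real.mul_rpow (hwi i) hx, ← Real.rpow_mul (hw i), one_div_mul_cancel hq.ne', Real.rpow_one]
  let σ := (Fintype.equivFin ι).symm
  have := hρ.conv _ H₀ (fun j t => w (σ j) ^ (1 / q) * H (σ j) t) h₀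
    (fun j => (hH _).const_mul (hwi _)) fun t => by
      rw [σ.sum_comp (fun i => (w i ^ (1 / q) * H i t) ^ q)]
      simpa only [e _ _ ((hH _).nonneg t)] using h t
  rw [σ.sum_comp (fun i => ρ (fun t => w i ^ (1 / q) * H i t) ^ q)] at this
  simpa only [hρ.smul _ _ (hwi _) (hH _), e _ _ (hρ.nonneg _)] using this

end

/-- The modulus of the linear form `t ↦ ∑ a_k t_k` on `ℂⁿ`. -/
noncomputable def linAbs {n : ℕ} (a t : Fin n → ℂ) : ℝ := ‖∑ k, a k * t k‖

/-- The square function of a finite family of linear forms on `ℂⁿ`. -/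
noncomputable def sqAbs {n : ℕ} {ι : Type*} [Fintype ι] (a : ι → Fin n → ℂ) (t : Fin n → ℂ) : ℝ :=
  √(∑ i, linAbs (a i) t ^ 2)

section

variable {n : ℕ}

theorem isNonnegHomog_linAbs (a : Fin n → ℂ) : IsNonnegHomog (linAbs a) := by
  refine ⟨by unfold linAbs; fun_prop, fun t => norm_nonneg _, fun c t hc => ?_⟩
  have : ∑ k, a k * (c • t) k = (c : ℂ) * ∑ k, a k * t k := by
    rw [Finset.mul_sum]
    refine Finset.sum_congr rfl fun k _ => ?_
    rw [Pi.smul_apply, Complex.real_smul]; ring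
  rw [linAbs, this, norm_mul, Complex.norm_real, Real.norm_of_nonneg hc, linAbs]

theorem isNonnegHomog_sqAbs {ι : Type*} [Fintype ι] (a : ι → Fin n → ℂ) :
    IsNonnegHomog (sqAbs a) := by
  refine ⟨?_, fun t => Real.sqrt_nonneg _, fun c t hc => ?_⟩
  · unfold sqAbs linAbs
    fun_prop
  · simp only [sqAbs, (isNonnegHomog_linAbs _).homog c t hc, mul_pow, ← Finset.mul_sum]
    rw [Real.sqrt_mul (sq_nonneg c), Real.sqrt_sq hc]

theorem linAbs_add_le (a b t : Fin n → ℂ) : linAbs (a + b) t ≤ linAbs a t + linAbs b t := by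
  simp only [linAbs, Pi.add_apply, add_mul, Finset.sum_add_distrib]
  exact norm_add_le _ _

theorem linAbs_smul {c : ℝ} (hc : 0 ≤ c) (a t : Fin n → ℂ) : linAbs (c • a) t = c * linAbs a t := by
  have : ∑ k, (c • a) k * t k = (c : ℂ) * ∑ k, a k * t k := by
    rw [Finset.mul_sum]
    refine Finset.sum_congr rfl fun k _ => ?_
    rw [Pi.smul_apply, Complex.real_smul]; ring
  rw [linAbs, this, norm_mul, Complex.norm_real, Real.norm_of_nonneg hc, linAbs]

theorem linAbs_sum_le {ι : Type*} (s : Finset ι) (b : ι → Fin n → ℂ) (t : Fin n → ℂ) :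
    linAbs (∑ i ∈ s, b i) t ≤ ∑ i ∈ s, linAbs (b i) t := by
  simp only [linAbs, Finset.sum_apply, Finset.sum_mul]
  rw [Finset.sum_comm]
  exact norm_sum_le _ _

theorem sqAbs_smul {ι : Type*} [Fintype ι] {c : ℝ} (hc : 0 ≤ c) (a : ι → Fin n → ℂ)
    (t : Fin n → ℂ) : sqAbs (fun i => c • a i) t = c * sqAbs a t := by
  simp only [sqAbs, linAbs_smul hc, mul_pow, ← Finset.mul_sum]
  rw [Real.sqrt_mul (sq_nonneg c), Real.sqrt_sq hc]

theorem isNonnegHomog_sum_norm : IsNonnegHomog fun t : Fin n → ℂ => ∑ k, ‖t k‖ := by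
  refine ⟨by fun_prop, fun t => by positivity, fun c t hc => ?_⟩
  simp only [Pi.smul_apply, norm_smul, Real.norm_of_nonneg hc, Finset.mul_sum]

theorem linAbs_le_sum_norm {a : Fin n → ℂ} (ha : ∀ k, ‖a k‖ ≤ 1) (t : Fin n → ℂ) :
    linAbs a t ≤ ∑ k, ‖t k‖ := by
  refine (norm_sum_le _ _).trans (Finset.sum_le_sum fun k _ => ?_)
  rw [norm_mul]
  exact mul_le_of_le_one_left (norm_nonneg _) (ha k)

/-- The square function is the norm of the `ℓ₂`-valued linear form with coefficients `(aᵢ(k))ᵢ`. -/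
theorem sqAbs_le_sum_norm {ι : Type*} [Fintype ι] {a : ι → Fin n → ℂ}
    (ha : ∀ k, ∑ i, ‖a i k‖ ^ 2 ≤ 1) (t : Fin n → ℂ) : sqAbs a t ≤ ∑ k, ‖t k‖ := by
  have e : sqAbs a t = ‖∑ k, t k • WithLp.toLp 2 fun i => a i k‖ := by
    rw [EuclideanSpace.norm_eq]
    simp only [sqAbs, linAbs]
    congr 1
    refine Finset.sum_congr rfl fun i _ => ?_
    simp [mul_comm]
  rw [e]
  refine (norm_sum_le _ _).trans (Finset.sum_le_sum fun k _ => ?_)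
  rw [norm_smul]
  refine mul_le_of_le_one_right (norm_nonneg _) ?_
  rw [EuclideanSpace.norm_eq]
  exact Real.sqrt_le_one.2 (ha k)

/-- The norm of the operator `a ↦ ∑ a_k t_k` from `ℓ_∞ⁿ`, measured by the gauge `ρ`. -/
noncomputable def gaugeNorm (n : ℕ) (ρ : ((Fin n → ℂ) → ℝ) → ℝ) : ℝ :=
  ⨆ a : {a : Fin n → ℂ // ∀ k, ‖a k‖ ≤ 1}, ρ (linAbs a.1)

/-- The least constant `C` with `ρ((∑ᵢ |T aᵢ|²)^{1/2}) ≤ C max_k (∑ᵢ |aᵢ(k)|²)^{1/2}`, where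
`T a = ∑ a_k t_k`. -/
noncomputable def gaugeSqNorm (n : ℕ) (ρ : ((Fin n → ℂ) → ℝ) → ℝ) : ℝ :=
  ⨆ a : (Σ m : ℕ, {a : Fin m → Fin n → ℂ // ∀ k, ∑ i, ‖a i k‖ ^ 2 ≤ 1}), ρ (sqAbs a.2.1)

variable {ρ : ((Fin n → ℂ) → ℝ) → ℝ} {q K : ℝ}

theorem IsConvexGauge.le_gaugeNorm (hρ : IsConvexGauge q K ρ) {a : Fin n → ℂ}
    (ha : ∀ k, ‖a k‖ ≤ 1) : ρ (linAbs a) ≤ gaugeNorm n ρ := by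
  refine le_ciSup (f := fun a : {a : Fin n → ℂ // ∀ k, ‖a k‖ ≤ 1} => ρ (linAbs a.1))
    ⟨ρ fun t => ∑ k, ‖t k‖, ?_⟩ ⟨a, ha⟩
  rintro _ ⟨b, rfl⟩
  exact hρ.mono _ _ (isNonnegHomog_linAbs _) isNonnegHomog_sum_norm (linAbs_le_sum_norm b.2)

theorem IsConvexGauge.gaugeNorm_nonneg (hρ : IsConvexGauge q K ρ) : 0 ≤ gaugeNorm n ρ :=
  Real.iSup_nonneg fun _ => hρ.nonneg _

theorem IsConvexGauge.gaugeSqNorm_nonneg (hρ : IsConvexGauge q K ρ) : 0 ≤ gaugeSqNorm n ρ :=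
  Real.iSup_nonneg fun _ => hρ.nonneg _

theorem IsConvexGauge.linAbs_le (hρ : IsConvexGauge q K ρ) {a : Fin n → ℂ} {c : ℝ} (hc : 0 < c)
    (ha : ∀ k, ‖a k‖ ≤ c) : ρ (linAbs a) ≤ c * gaugeNorm n ρ := by
  have e : linAbs a = fun t => c * linAbs (c⁻¹ • a) t := by
    funext t
    rw [linAbs_smul (inv_nonneg.2 hc.le), mul_inv_cancel_left₀ hc.ne']
  rw [e, hρ.smul _ _ hc.le (isNonnegHomog_linAbs _)]
  refine mul_le_mul_of_nonneg_left (hρ.le_gaugeNorm fun k => ?_) hc.le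
  rw [Pi.smul_apply, norm_smul, norm_inv, Real.norm_of_nonneg hc.le, inv_mul_le_iff₀ hc, mul_one]
  exact ha k

theorem IsConvexGauge.sqAbs_le (hρ : IsConvexGauge q K ρ) {ι : Type*} [Fintype ι]
    {a : ι → Fin n → ℂ} {c : ℝ} (hc : 0 < c) (ha : ∀ k, ∑ i, ‖a i k‖ ^ 2 ≤ c ^ 2) :
    ρ (sqAbs a) ≤ c * gaugeSqNorm n ρ := by
  let σ := (Fintype.equivFin ι).symm
  let b : Fin (Fintype.card ι) → Fin n → ℂ := fun j => c⁻¹ • a (σ j)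
  have hb : ∀ k, ∑ j, ‖b j k‖ ^ 2 ≤ 1 := fun k => by
    have h1 : ∀ j, ‖b j k‖ ^ 2 = (c ^ 2)⁻¹ * ‖a (σ j) k‖ ^ 2 := fun j => by
      simp only [b, Pi.smul_apply, norm_smul, norm_inv, Real.norm_of_nonneg hc.le, mul_pow,
        inv_pow]
    simp only [h1, ← Finset.mul_sum]
    rw [σ.sum_comp fun i => ‖a i k‖ ^ 2, inv_mul_le_iff₀ (by positivity), mul_one]
    exact ha k
  have e : sqAbs a = fun t => c * sqAbs b t := by
    funext t
    simp only [b]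
    rw [sqAbs_smul (inv_nonneg.2 hc.le) (fun j => a (σ j)), mul_inv_cancel_left₀ hc.ne']
    simp only [sqAbs]
    rw [σ.sum_comp fun i => linAbs (a i) t ^ 2]
  rw [e, hρ.smul _ _ hc.le (isNonnegHomog_sqAbs _)]
  refine mul_le_mul_of_nonneg_left ?_ hc.le
  refine le_ciSup (f := fun a : (Σ m : ℕ, {a : Fin m → Fin n → ℂ //
    ∀ k, ∑ i, ‖a i k‖ ^ 2 ≤ 1}) => ρ (sqAbs a.2.1)) ⟨ρ fun t => ∑ k, ‖t k‖, ?_⟩ ⟨_, b, hb⟩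
  rintro _ ⟨b, rfl⟩
  exact hρ.mono _ _ (isNonnegHomog_sqAbs _) isNonnegHomog_sum_norm (sqAbs_le_sum_norm b.2.2)

/-! ### A Grothendieck inequality for convex gauges -/

/-- Khinchin's inequality for the family `T aᵢ`, followed by a truncation at level `l` of the random
coefficients `∑ᵢ rᵢ aᵢ(k)`.  The truncated part is bounded; the remainder has small variance because
the fourth moments are bounded, and is kept as a square function. -/
theorem exists_truncation {m : ℕ} (a : Fin m → Fin n → ℂ) (ha : ∀ k, ∑ i, ‖a i k‖ ^ 2 ≤ 1)
    (hq : 0 < q) (hq1 : q ≤ 1) {l : ℝ} (hl : 0 < l) :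
    ∃ (v w : (Fin m → ℤˣ) → Fin n → ℂ), (∀ r k, ‖v r k‖ ≤ l) ∧
      (∀ k, ∑ r, ‖w r k‖ ^ 2 ≤ (√3 / l) ^ 2) ∧
      ∀ t, sqAbs a t ^ q ≤ 12 * sqAbs w t ^ q + ∑ r, 12 / 2 ^ m * linAbs (v r) t ^ q := by
  classical
  have h2m : (0 : ℝ) < 2 ^ m := by positivity
  let u : (Fin m → ℤˣ) → Fin n → ℂ := fun r k => signSum (fun i => a i k) r
  let v : (Fin m → ℤˣ) → Fin n → ℂ := fun r k => if ‖u r k‖ ≤ l then u r k else 0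
  let w : (Fin m → ℤˣ) → Fin n → ℂ := fun r k => if ‖u r k‖ ≤ l then 0 else u r k
  let c : ℝ := √(2 ^ m)⁻¹
  have hc0 : 0 ≤ c := Real.sqrt_nonneg _
  have hc2 : c ^ 2 = (2 ^ m)⁻¹ := Real.sq_sqrt (by positivity)
  refine ⟨v, fun r => c • w r, fun r k => ?_, fun k => ?_, fun t => ?_⟩
  · simp only [v]
    split_ifs with h
    · exact h
    · simpa using hl.le
  · have h1 : ∀ r, ‖(c • w r) k‖ ^ 2 ≤ (2 ^ m)⁻¹ * (‖u r k‖ ^ 4 / l ^ 2) := fun r => by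
      rw [Pi.smul_apply, norm_smul, mul_pow, Real.norm_of_nonneg hc0, hc2]
      refine mul_le_mul_of_nonneg_left ?_ (by positivity)
      simp only [w]
      split_ifs with h
      · rw [norm_zero, zero_pow two_ne_zero]; positivity
      · rw [le_div_iff₀ (by positivity)]
        have : l ^ 2 ≤ ‖u r k‖ ^ 2 := pow_le_pow_left₀ hl.le (not_le.1 h).le 2
        nlinarith [sq_nonneg ‖u r k‖]
    refine (Finset.sum_le_sum fun r _ => h1 r).trans ?_
    rw [← Finset.mul_sum, ← Finset.sum_div, inv_mul_le_iff₀ h2m, div_pow,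
      Real.sq_sqrt (by norm_num), mul_div_assoc']
    refine div_le_div_of_nonneg_right ((sum_norm_signSum_pow_four _).trans ?_) (by positivity)
    refine mul_le_mul_of_nonneg_left ?_ h2m.le
    have h0 : 0 ≤ ∑ i, ‖a i k‖ ^ 2 := by positivity
    nlinarith [ha k]
  · have hu : ∀ r, signSum (fun i => ∑ k, a i k * t k) r = ∑ k, u r k * t k := fun r => by
      simp only [signSum, u, Finset.mul_sum, Finset.sum_mul]
      rw [Finset.sum_comm]
      exact Finset.sum_congr rfl fun k _ => Finset.sum_congr rfl fun i _ => by ring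
    have hkh := khinchin (fun i => ∑ k, a i k * t k) hq hq1
    simp only [hu] at hkh
    change 2 ^ m * sqAbs a t ^ q ≤ 12 * ∑ r, linAbs (u r) t ^ q at hkh
    have hsplit : ∀ r, linAbs (u r) t ^ q ≤ linAbs (v r) t ^ q + linAbs (w r) t ^ q := fun r => by
      have e : u r = v r + w r := by
        funext k
        simp only [v, w, Pi.add_apply]
        split_ifs <;> simp
      rw [e]
      refine (Real.rpow_le_rpow (norm_nonneg _) (linAbs_add_le _ _ _) hq.le).trans ?_
      exact Real.rpow_add_le_add_rpow (norm_nonneg _) (norm_nonneg _) hq.le hq1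
    have hcard : ∑ _r : Fin m → ℤˣ, ((2 : ℝ) ^ m)⁻¹ = 1 := by
      simp [Finset.card_univ]
    have hjensen : ∑ r, (2 ^ m)⁻¹ * linAbs (w r) t ^ q ≤ sqAbs (fun r => c • w r) t ^ q := by
      have := Real.arith_mean_le_rpow_mean Finset.univ (fun _ : Fin m → ℤˣ => ((2 : ℝ) ^ m)⁻¹)
        (fun r => linAbs (w r) t ^ q) (fun _ _ => by positivity) hcard
        (fun r _ => Real.rpow_nonneg (norm_nonneg _) _) (p := 2 / q)
        (by rw [le_div_iff₀ hq]; linarith)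
      refine this.trans (le_of_eq ?_)
      have e : ∀ r, (linAbs (w r) t ^ q) ^ (2 / q) = linAbs (w r) t ^ 2 := fun r => by
        rw [← Real.rpow_mul (show 0 ≤ linAbs (w r) t from norm_nonneg _),
          mul_div_cancel₀ _ hq.ne', Real.rpow_two]
      simp only [e, sqAbs, linAbs_smul hc0, mul_pow, hc2]
      rw [Real.sqrt_eq_rpow, ← Real.rpow_mul (by positivity)]
      congr 1
      field_simp
    have h3 := Finset.sum_le_sum fun r (_ : r ∈ Finset.univ) => hsplit r
    rw [Finset.sum_add_distrib] at h3
    rw [← Finset.mul_sum] at hjensen ⊢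
    rw [inv_mul_le_iff₀ h2m] at hjensen
    refine le_of_mul_le_mul_left ?_ h2m
    have e : (2 : ℝ) ^ m * (12 / 2 ^ m * ∑ r, linAbs (v r) t ^ q) =
      12 * ∑ r, linAbs (v r) t ^ q := by field_simp
    rw [mul_add, e]
    linarith

theorem IsConvexGauge.sqAbs_rpow_le (hρ : IsConvexGauge q K ρ) (hq : 0 < q) (hq1 : q ≤ 1)
    (hK : 0 ≤ K) {m : ℕ} (a : Fin m → Fin n → ℂ) (ha : ∀ k, ∑ i, ‖a i k‖ ^ 2 ≤ 1) {l : ℝ}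
    (hl : 0 < l) :
    ρ (sqAbs a) ^ q ≤
      12 * K * (√3 / l) ^ q * gaugeSqNorm n ρ ^ q + 12 * K * l ^ q * gaugeNorm n ρ ^ q := by
  obtain ⟨v, w, hv, hw, h⟩ := exists_truncation a ha hq hq1 hl
  have hs : 0 < √3 / l := by positivity
  have h1 := hρ.rpow_le hq (ι := Option (Fin m → ℤˣ)) (H₀ := sqAbs a)
    (w := fun o => o.elim 12 fun _ => 12 / 2 ^ m)
    (H := fun o => o.elim (sqAbs w) fun r => linAbs (v r))
    (by rintro (_ | r) <;> simp only [Option.elim] <;> positivity)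
    (isNonnegHomog_sqAbs a)
    (by rintro (_ | r); exacts [isNonnegHomog_sqAbs _, isNonnegHomog_linAbs _])
    (fun t => by simpa [Fintype.sum_option] using h t)
  simp only [Fintype.sum_option, Option.elim] at h1
  refine h1.trans ?_
  have h2 : ρ (sqAbs w) ^ q ≤ (√3 / l) ^ q * gaugeSqNorm n ρ ^ q := by
    rw [← Real.mul_rpow hs.le hρ.gaugeSqNorm_nonneg]
    exact Real.rpow_le_rpow (hρ.nonneg _) (hρ.sqAbs_le hs hw) hq.le
  have h3 : ∀ r, ρ (linAbs (v r)) ^ q ≤ l ^ q * gaugeNorm n ρ ^ q := fun r => by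
    rw [← Real.mul_rpow hl.le hρ.gaugeNorm_nonneg]
    exact Real.rpow_le_rpow (hρ.nonneg _) (hρ.linAbs_le hl (hv r)) hq.le
  have h4 : ∑ r, 12 / 2 ^ m * ρ (linAbs (v r)) ^ q ≤ 12 * (l ^ q * gaugeNorm n ρ ^ q) := by
    refine (Finset.sum_le_sum fun r _ => mul_le_mul_of_nonneg_left (h3 r) (by positivity)).trans
      (le_of_eq ?_)
    simp only [Finset.sum_const, Finset.card_univ, Fintype.card_fun, Fintype.card_units_int,
      Fintype.card_fin, nsmul_eq_mul]
    push_cast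
    field_simp
  calc K * (12 * ρ (sqAbs w) ^ q + ∑ r, 12 / 2 ^ m * ρ (linAbs (v r)) ^ q)
      ≤ K * (12 * ((√3 / l) ^ q * gaugeSqNorm n ρ ^ q) + 12 * (l ^ q * gaugeNorm n ρ ^ q)) := by
        gcongr
    _ = _ := by ring

/-- Grothendieck's inequality for a convex gauge: the square function constant is controlled by the
norm. -/
theorem exists_gaugeSqNorm_le (hq : 0 < q) (hq1 : q ≤ 1) (hK : 0 < K) :
    ∃ C : ℝ, 0 < C ∧ ∀ (n : ℕ) (ρ : ((Fin n → ℂ) → ℝ) → ℝ), IsConvexGauge q K ρ →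
      gaugeSqNorm n ρ ≤ C * gaugeNorm n ρ := by
  -- With this level `l`, the coefficient of `gaugeSqNorm` in the truncation estimate is `1/2`.
  set κ : ℝ := (1 / (24 * K)) ^ (1 / q) with hκ
  have hκ0 : 0 < κ := by positivity
  have hκq : κ ^ q = 1 / (24 * K) := by
    rw [hκ, ← Real.rpow_mul (by positivity), one_div_mul_cancel hq.ne', Real.rpow_one]
  set l : ℝ := √3 / κ with hl
  have hl0 : 0 < l := by positivity
  have hlκ : √3 / l = κ := by rw [hl]; field_simp
  refine ⟨κ⁻¹ * l, by positivity, fun n ρ hρ => ?_⟩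
  have hN := hρ.gaugeNorm_nonneg
  have hG := hρ.gaugeSqNorm_nonneg
  have hle : gaugeSqNorm n ρ ≤
      (1 / 2 * gaugeSqNorm n ρ ^ q + 12 * K * l ^ q * gaugeNorm n ρ ^ q) ^ (1 / q) := by
    refine Real.iSup_le (fun a => ?_) (by positivity)
    have := hρ.sqAbs_rpow_le hq hq1 hK.le a.2.1 a.2.2 hl0
    rw [hlκ, hκq] at this
    rw [one_div q, Real.le_rpow_inv_iff_of_pos (hρ.nonneg _) (by positivity) hq]
    refine this.trans (le_of_eq ?_)
    congr 2
    field_simp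
    norm_num
  rw [one_div q, Real.le_rpow_inv_iff_of_pos hG (by positivity) hq] at hle
  rw [← Real.rpow_le_rpow_iff hG (by positivity) hq, Real.mul_rpow (by positivity) hN,
    Real.mul_rpow (by positivity) hl0.le, Real.inv_rpow hκ0.le, hκq]
  have e : (1 / (24 * K))⁻¹ = 24 * K := by simp
  rw [e]
  linarith

section

variable {q K : ℝ}

/-- An `ℓ₁` sum is at most a small multiple of an `ℓ₂` sum plus a large multiple of an `ℓ_q` sum. -/
theorem exists_sum_rpow_le (hq : 0 < q) (hq1 : q ≤ 1) {η : ℝ} (hη : 0 < η) :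
    ∃ A : ℝ, 0 < A ∧ ∀ {ι : Type} [Fintype ι] (c x : ι → ℝ), (∀ i, 0 ≤ c i) → (∀ i, 0 ≤ x i) →
      (∑ i, c i * x i) ^ q ≤ (2 * η) ^ q * √(∑ i, c i * x i ^ 2) ^ q + A * ∑ i, c i * x i ^ q := by
  -- `τ` is the threshold with `τ ^ (-q) * η ^ (q - 1) = η`.
  set τ : ℝ := η ^ (-(2 - q) / q) with hτ
  have hτ0 : 0 < τ := by positivity
  refine ⟨((τ / η) ^ (1 - q)) ^ q, by positivity, fun {ι} _ c x hc hx => ?_⟩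
  set B := √(∑ i, c i * x i ^ 2) with hB
  set S := ∑ i, c i * x i ^ q with hS
  have hS0 : 0 ≤ S := Finset.sum_nonneg fun i _ => mul_nonneg (hc i) (Real.rpow_nonneg (hx i) _)
  have hsum0 : 0 ≤ ∑ i, c i * x i := Finset.sum_nonneg fun i _ => mul_nonneg (hc i) (hx i)
  have hB2 : B ^ 2 = ∑ i, c i * x i ^ 2 :=
    Real.sq_sqrt (Finset.sum_nonneg fun i _ => mul_nonneg (hc i) (sq_nonneg _))
  rcases (Real.sqrt_nonneg (∑ i, c i * x i ^ 2)).eq_or_lt with h0 | h0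
  · rw [← hB] at h0
    rw [← h0, zero_pow two_ne_zero, eq_comm, Finset.sum_eq_zero_iff_of_nonneg
      fun i _ => mul_nonneg (hc i) (sq_nonneg _)] at hB2
    have : ∑ i, c i * x i = 0 := Finset.sum_eq_zero fun i hi => by
      rcases mul_eq_zero.1 (hB2 i hi) with h | h
      · rw [h, zero_mul]
      · rw [pow_eq_zero_iff two_ne_zero] at h
        rw [h, mul_zero]
    rw [this, Real.zero_rpow hq.ne']
    positivity
  rw [← hB] at h0
  set s := B / η with hs
  have hs0 : 0 < s := by positivity
  have hpt : ∀ y : ℝ, 0 ≤ y → y ≤ s ^ (1 - q) * y ^ q + y ^ 2 / s := by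
    intro y hy
    rcases hy.eq_or_lt with rfl | hy0
    · rw [Real.zero_rpow hq.ne']; simp
    rcases le_total y s with h | h
    · have e : y = y ^ (1 - q) * y ^ q := by
        rw [← Real.rpow_add hy0, sub_add_cancel, Real.rpow_one]
      have h1 := Real.rpow_le_rpow hy h (show 0 ≤ 1 - q by linarith)
      have h2 := mul_le_mul_of_nonneg_right h1 (Real.rpow_nonneg hy q)
      have : 0 ≤ y ^ 2 / s := by positivity
      linarith
    · have : y ≤ y ^ 2 / s := by rw [le_div_iff₀ hs0]; nlinarith
      have : 0 ≤ s ^ (1 - q) * y ^ q := by positivity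
      linarith
  have h1 : ∑ i, c i * x i ≤ s ^ (1 - q) * S + η * B := by
    have := Finset.sum_le_sum fun i (_ : i ∈ Finset.univ) =>
      mul_le_mul_of_nonneg_left (hpt (x i) (hx i)) (hc i)
    refine this.trans (le_of_eq ?_)
    have e : η * B = B ^ 2 / s := by rw [hs]; field_simp
    rw [e, hB2, hS, Finset.mul_sum, Finset.sum_div, ← Finset.sum_add_distrib]
    exact Finset.sum_congr rfl fun i _ => by ring
  have h2 : s ^ (1 - q) * S ≤ η * B + (τ / η) ^ (1 - q) * S ^ (1 / q) := by
    set A := S ^ (1 / q) with hA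
    have hA0 : 0 ≤ A := Real.rpow_nonneg hS0 _
    have hAq : S = A ^ q := by
      rw [hA, ← Real.rpow_mul hS0, one_div_mul_cancel hq.ne', Real.rpow_one]
    have h1q : 0 ≤ 1 - q := by linarith
    rcases le_or_gt B (τ * A) with h | h
    · have hA0' : 0 < A := by
        by_contra hcon
        have : A = 0 := le_antisymm (not_lt.1 hcon) hA0
        rw [this, mul_zero] at h
        linarith
      have h3 : s ^ (1 - q) ≤ (τ / η) ^ (1 - q) * A ^ (1 - q) := by
        rw [← Real.mul_rpow (by positivity) hA0]
        refine Real.rpow_le_rpow hs0.le ?_ h1q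
        rw [hs, div_mul_eq_mul_div]
        gcongr
      have h4 := mul_le_mul_of_nonneg_right h3 hS0
      have e : A ^ (1 - q) * S = A := by
        rw [hAq, ← Real.rpow_add hA0', sub_add_cancel, Real.rpow_one]
      rw [mul_assoc, e] at h4
      have : 0 ≤ η * B := by positivity
      linarith
    · have h3 : A ≤ τ⁻¹ * B := by rw [le_inv_mul_iff₀ hτ0]; exact h.le
      have h4 : S ≤ (τ⁻¹ * B) ^ q := by rw [hAq]; exact Real.rpow_le_rpow hA0 h3 hq.le
      have h5 : s ^ (1 - q) * (τ⁻¹ * B) ^ q = η * B := by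
        have hτq : τ⁻¹ ^ q = η ^ (2 - q) := by
          rw [Real.inv_rpow hτ0.le, hτ, ← Real.rpow_mul hη.le, ← Real.rpow_neg hη.le]
          congr 1
          field_simp
        rw [hs, Real.mul_rpow (by positivity) h0.le, Real.div_rpow h0.le hη.le, hτq]
        have e1 : B ^ (1 - q) * B ^ q = B := by
          rw [← Real.rpow_add h0, sub_add_cancel, Real.rpow_one]
        have e2 : η ^ (2 - q) = η * η ^ (1 - q) := by
          rw [← Real.rpow_one_add' hη.le (by linarith)]
          congr 1; ring
        rw [e2]
        have : η ^ (1 - q) ≠ 0 := by positivity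
        field_simp
        exact e1
      have h6 := mul_le_mul_of_nonneg_left h4 (Real.rpow_nonneg hs0.le (1 - q))
      have : 0 ≤ (τ / η) ^ (1 - q) * A := by positivity
      linarith
  have h3 : ∑ i, c i * x i ≤ 2 * η * B + (τ / η) ^ (1 - q) * S ^ (1 / q) := by linarith
  have hSq : 0 ≤ S ^ (1 / q) := Real.rpow_nonneg hS0 _
  refine (Real.rpow_le_rpow hsum0 h3 hq.le).trans ?_
  refine (Real.rpow_add_le_add_rpow (by positivity) (by positivity) hq.le hq1).trans ?_
  rw [Real.mul_rpow (by positivity) h0.le, Real.mul_rpow (by positivity) hSq,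
    ← Real.rpow_mul hS0, one_div_mul_cancel hq.ne', Real.rpow_one]

/-- If every point of the unit ball of `ℓ_∞ⁿ` is close to a combination, with coefficients
of sum at most `M`, of points `b` of the ball with `ρ(T b) ≤ D`, then `‖T‖ ≤ C D`. For a norm this
is the triangle inequality; for a `q`-convex gauge, the `ℓ₁` sum `∑ cᵢ |T bᵢ|` is interpolated
between an `ℓ_q` sum, controlled by `D`, and a square function, controlled by `‖T‖` itself. -/
theorem exists_gaugeNorm_le (hq : 0 < q) (hq1 : q ≤ 1) (hK : 0 < K) {M : ℝ} (hM : 0 < M) :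
    ∃ C : ℝ, 0 < C ∧ ∀ (n : ℕ) (ρ : ((Fin n → ℂ) → ℝ) → ℝ) (D : ℝ), IsConvexGauge q K ρ → 0 ≤ D →
      (∀ (a : Fin n → ℂ) (ξ : ℝ), (∀ k, ‖a k‖ ≤ 1) → 0 < ξ →
        ∃ (ι : Type) (_ : Fintype ι) (c : ι → ℝ) (b : ι → Fin n → ℂ), (∀ i, 0 ≤ c i) ∧
          ∑ i, c i ≤ M ∧ (∀ i k, ‖b i k‖ ≤ 1) ∧ (∀ i, ρ (linAbs (b i)) ≤ D) ∧
          ∀ k, ‖(a - ∑ i, c i • b i) k‖ ≤ ξ) →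
      gaugeNorm n ρ ≤ C * D := by
  obtain ⟨C₀, hC₀, hgro⟩ := exists_gaugeSqNorm_le hq hq1 hK
  set κ : ℝ := (1 / (4 * K)) ^ (1 / q) with hκ
  have hκ0 : 0 < κ := by positivity
  have hκq : κ ^ q = 1 / (4 * K) := by
    rw [hκ, ← Real.rpow_mul (by positivity), one_div_mul_cancel hq.ne', Real.rpow_one]
  -- With this `η` and with `ξ = κ`, the two terms containing `‖T‖ ^ q` get the coefficient `1/4`.
  set η : ℝ := κ / (2 * (√M * C₀)) with hη
  have hη0 : 0 < η := by positivity
  obtain ⟨A, hA, hsum⟩ := exists_sum_rpow_le hq hq1 hη0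
  refine ⟨(2 * K * A * M) ^ (1 / q), by positivity, fun n ρ D hρ hD hdense => ?_⟩
  have hN := hρ.gaugeNorm_nonneg
  have hG := hρ.gaugeSqNorm_nonneg
  have hle : gaugeNorm n ρ ≤
      (1 / 2 * gaugeNorm n ρ ^ q + K * A * M * D ^ q) ^ (1 / q) := by
    refine Real.iSup_le (fun a => ?_) (by positivity)
    rw [one_div q, Real.le_rpow_inv_iff_of_pos (hρ.nonneg _) (by positivity) hq]
    obtain ⟨a, ha⟩ := a
    obtain ⟨ι, hι, c, b, hc, hcM, hb, hbD, hab⟩ := hdense a κ ha hκ0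
    let B : ι → Fin n → ℂ := fun i => √(c i) • b i
    have hpt : ∀ t, linAbs a t ^ q ≤ linAbs (a - ∑ i, c i • b i) t ^ q +
        ((2 * η) ^ q * sqAbs B t ^ q + ∑ i, A * c i * linAbs (b i) t ^ q) := by
      intro t
      have h1 : linAbs a t ≤ linAbs (a - ∑ i, c i • b i) t + ∑ i, c i * linAbs (b i) t := by
        have e : a = (a - ∑ i, c i • b i) + ∑ i, c i • b i := by abel
        conv_lhs => rw [e]
        refine (linAbs_add_le _ _ _).trans (add_le_add_right ?_ _)
        refine (linAbs_sum_le _ _ _).trans (le_of_eq ?_)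
        exact Finset.sum_congr rfl fun i _ => linAbs_smul (hc i) _ _
      have h2 := hsum c (fun i => linAbs (b i) t) hc fun i => norm_nonneg _
      have e : ∀ i, c i * linAbs (b i) t ^ 2 = linAbs (B i) t ^ 2 := fun i => by
        simp only [B]
        rw [linAbs_smul (Real.sqrt_nonneg _), mul_pow, Real.sq_sqrt (hc i)]
      simp only [e] at h2
      refine (Real.rpow_le_rpow (norm_nonneg _) h1 hq.le).trans ?_
      refine (Real.rpow_add_le_add_rpow (norm_nonneg _)
        (Finset.sum_nonneg fun i _ => mul_nonneg (hc i) (norm_nonneg _)) hq.le hq1).trans ?_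
      refine add_le_add_right (h2.trans (le_of_eq ?_)) _
      rw [sqAbs, Finset.mul_sum]
      congr 1
      exact Finset.sum_congr rfl fun i _ => by ring
    have h1 := hρ.rpow_le hq (ι := Option (Option ι)) (H₀ := linAbs a)
      (w := fun o => o.elim 1 fun o => o.elim ((2 * η) ^ q) fun i => A * c i)
      (H := fun o => o.elim (linAbs (a - ∑ i, c i • b i)) fun o =>
        o.elim (sqAbs B) fun i => linAbs (b i))
      (by
        rintro (_ | _ | i) <;> simp only [Option.elim]
        · positivity
        · positivity
        · exact mul_nonneg hA.le (hc i))
      (isNonnegHomog_linAbs a)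
      (by
        rintro (_ | _ | i)
        exacts [isNonnegHomog_linAbs _, isNonnegHomog_sqAbs _, isNonnegHomog_linAbs _])
      (fun t => by simpa [Fintype.sum_option] using hpt t)
    simp only [Fintype.sum_option, Option.elim, one_mul] at h1
    refine h1.trans ?_
    have h2 : ρ (linAbs (a - ∑ i, c i • b i)) ^ q ≤ 1 / (4 * K) * gaugeNorm n ρ ^ q := by
      rw [← hκq, ← Real.mul_rpow hκ0.le hN]
      exact Real.rpow_le_rpow (hρ.nonneg _) (hρ.linAbs_le hκ0 hab) hq.le
    have h3 : (2 * η) ^ q * ρ (sqAbs B) ^ q ≤ 1 / (4 * K) * gaugeNorm n ρ ^ q := by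
      rw [← hκq, ← Real.mul_rpow hκ0.le hN, ← Real.mul_rpow (by positivity) (hρ.nonneg _)]
      refine Real.rpow_le_rpow (mul_nonneg (by positivity) (hρ.nonneg _)) ?_ hq.le
      have hB : ∀ k, ∑ i, ‖B i k‖ ^ 2 ≤ √M ^ 2 := fun k => by
        rw [Real.sq_sqrt hM.le]
        refine (Finset.sum_le_sum fun i _ => ?_).trans hcM
        simp only [B, Pi.smul_apply]
        rw [norm_smul, mul_pow, Real.norm_of_nonneg (Real.sqrt_nonneg _), Real.sq_sqrt (hc i)]
        exact mul_le_of_le_one_right (hc i) (pow_le_one₀ (norm_nonneg _) (hb i k))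
      have h4 := (hρ.sqAbs_le (Real.sqrt_pos.2 hM) hB).trans
        (mul_le_mul_of_nonneg_left (hgro n ρ hρ) (Real.sqrt_nonneg _))
      refine (mul_le_mul_of_nonneg_left h4 (by positivity)).trans (le_of_eq ?_)
      rw [hη]
      field_simp
    have h4 : ∑ i, A * c i * ρ (linAbs (b i)) ^ q ≤ A * M * D ^ q := by
      have h5 : ∀ i, ρ (linAbs (b i)) ^ q ≤ D ^ q := fun i =>
        Real.rpow_le_rpow (hρ.nonneg _) (hbD i) hq.le
      refine (Finset.sum_le_sum fun i _ => mul_le_mul_of_nonneg_left (h5 i)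
        (mul_nonneg hA.le (hc i))).trans ?_
      rw [← Finset.sum_mul, ← Finset.mul_sum]
      gcongr
    calc K * (ρ (linAbs (a - ∑ i, c i • b i)) ^ q + ((2 * η) ^ q * ρ (sqAbs B) ^ q +
          ∑ i, A * c i * ρ (linAbs (b i)) ^ q))
        ≤ K * (1 / (4 * K) * gaugeNorm n ρ ^ q + (1 / (4 * K) * gaugeNorm n ρ ^ q +
          A * M * D ^ q)) := by gcongr
      _ = _ := by field_simp; ring
  rw [one_div q, Real.le_rpow_inv_iff_of_pos hN (by positivity) hq] at hle
  rw [← Real.rpow_le_rpow_iff hN (by positivity) hq, Real.mul_rpow (by positivity) hD,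
    ← Real.rpow_mul (by positivity), one_div_mul_cancel hq.ne', Real.rpow_one]
  linarith

/-! ### Lowering the exponent of convexity -/

/-- A `q`-convex gauge is `s`-convex for `0 < s ≤ q`: apply `q`-convexity to the multiples
`dᵢ^{s/q-1} Hᵢ`, where `dᵢ` is slightly larger than `ρ(Hᵢ)`. -/
theorem IsConvexGauge.of_le {V : Type*} [TopologicalSpace V] [AddCommGroup V] [Module ℝ V]
    {ρ : (V → ℝ) → ℝ} (hρ : IsConvexGauge q K ρ) {s : ℝ} (hs : 0 < s) (hsq : s ≤ q) (hK : 0 ≤ K) :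
    IsConvexGauge s (K ^ (s / q)) ρ := by
  have hq : 0 < q := hs.trans_le hsq
  refine ⟨hρ.nonneg, hρ.mono, hρ.smul, fun m H₀ H h₀ hH h => ?_⟩
  have key : ∀ d : Fin m → ℝ, (∀ i, 0 < d i) → (∀ i, ρ (H i) ≤ d i) →
      ρ H₀ ^ s ≤ K ^ (s / q) * ∑ i, d i ^ s := by
    intro d hd hρd
    set S := ∑ i, d i ^ s with hS
    have hS0 : 0 ≤ S := Finset.sum_nonneg fun i _ => Real.rpow_nonneg (hd i).le _
    have hqs : 1 ≤ q / s := (one_le_div hs).2 hsq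
    have hpt : ∀ t, H₀ t ^ q ≤ ∑ i, (S ^ (q / s - 1) * d i ^ (s - q)) * H i t ^ q := by
      intro t
      have h1 : (H₀ t ^ s) ^ (q / s) ≤ (∑ i, d i ^ s * (H i t / d i) ^ s) ^ (q / s) := by
        refine Real.rpow_le_rpow (Real.rpow_nonneg (h₀.nonneg t) _) ((h t).trans (le_of_eq ?_))
          (by positivity)
        refine Finset.sum_congr rfl fun i _ => ?_
        rw [← Real.mul_rpow (hd i).le (div_nonneg ((hH i).nonneg t) (hd i).le),
          mul_div_cancel₀ _ (hd i).ne']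
      rw [← Real.rpow_mul (h₀.nonneg t), mul_div_cancel₀ _ hs.ne'] at h1
      refine h1.trans ?_
      rcases isEmpty_or_nonempty (Fin m) with hm | hm
      · simp [Real.zero_rpow (show q / s ≠ 0 by positivity)]
      have hSpos : 0 < S :=
        Finset.sum_pos (fun i _ => Real.rpow_pos_of_pos (hd i) _) Finset.univ_nonempty
      have hz : ∀ i, 0 ≤ H i t / d i := fun i => div_nonneg ((hH i).nonneg t) (hd i).le
      have h2 := Real.rpow_arith_mean_le_arith_mean_rpow Finset.univ (fun i => d i ^ s / S)
        (fun i => (H i t / d i) ^ s)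
        (fun i _ => div_nonneg (Real.rpow_nonneg (hd i).le _) hS0)
        (by rw [← Finset.sum_div, ← hS, div_self hSpos.ne'])
        (fun i _ => Real.rpow_nonneg (hz i) _) hqs
      have e1 : ∑ i, d i ^ s * (H i t / d i) ^ s =
          S * ∑ i, d i ^ s / S * (H i t / d i) ^ s := by
        rw [Finset.mul_sum]
        exact Finset.sum_congr rfl fun i _ => by field_simp
      rw [e1, Real.mul_rpow hS0 (Finset.sum_nonneg fun i _ => mul_nonneg
        (div_nonneg (Real.rpow_nonneg (hd i).le _) hS0) (Real.rpow_nonneg (hz i) _))]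
      refine (mul_le_mul_of_nonneg_left h2 (Real.rpow_nonneg hS0 _)).trans (le_of_eq ?_)
      rw [Finset.mul_sum]
      refine Finset.sum_congr rfl fun i _ => ?_
      rw [← Real.rpow_mul (hz i), mul_div_cancel₀ _ hs.ne',
        Real.div_rpow ((hH i).nonneg t) (hd i).le, Real.rpow_sub_one hSpos.ne',
        Real.rpow_sub (hd i)]
      field_simp
    have h2 := hρ.rpow_le hq (fun i => mul_nonneg (Real.rpow_nonneg hS0 _)
      (Real.rpow_nonneg (hd i).le _)) h₀ hH hpt
    have h3 : ρ H₀ ^ q ≤ K * S ^ (q / s) := by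
      refine h2.trans (mul_le_mul_of_nonneg_left ?_ hK)
      have h4 : ∀ i, S ^ (q / s - 1) * d i ^ (s - q) * ρ (H i) ^ q ≤ S ^ (q / s - 1) * d i ^ s := by
        intro i
        rw [mul_assoc]
        refine mul_le_mul_of_nonneg_left ?_ (Real.rpow_nonneg hS0 _)
        refine (mul_le_mul_of_nonneg_left (Real.rpow_le_rpow (hρ.nonneg _) (hρd i) hq.le)
          (Real.rpow_nonneg (hd i).le _)).trans (le_of_eq ?_)
        rw [← Real.rpow_add (hd i), sub_add_cancel]
      refine (Finset.sum_le_sum fun i _ => h4 i).trans (le_of_eq ?_)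
      rw [← Finset.mul_sum, ← hS]
      rcases hS0.eq_or_lt with h0 | h0
      · rw [← h0, mul_zero, Real.zero_rpow (by positivity)]
      · rw [← Real.rpow_add_one h0.ne', sub_add_cancel]
    have h4 := Real.rpow_le_rpow (Real.rpow_nonneg (hρ.nonneg _) _) h3
      (show 0 ≤ s / q by positivity)
    rw [← Real.rpow_mul (hρ.nonneg _), mul_div_cancel₀ _ hq.ne',
      Real.mul_rpow hK (Real.rpow_nonneg hS0 _), ← Real.rpow_mul hS0] at h4
    have e : q / s * (s / q) = 1 := by field_simp
    rwa [e, Real.rpow_one] at h4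
  have hlim : Tendsto (fun δ : ℝ => K ^ (s / q) * ∑ i, (ρ (H i) + δ) ^ s) (𝓝[>] 0)
      (𝓝 (K ^ (s / q) * ∑ i, (ρ (H i) + 0) ^ s)) := by
    refine Tendsto.mono_left (Continuous.tendsto ?_ 0) nhdsWithin_le_nhds
    refine continuous_const.mul (continuous_finsetSum _ fun i _ => ?_)
    exact (continuous_const.add continuous_id).rpow_const fun _ => Or.inr hs.le
  simp only [add_zero] at hlim
  refine ge_of_tendsto hlim ?_
  filter_upwards [self_mem_nhdsWithin] with δ hδ
  have hδ' : 0 < δ := hδ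
  exact key (fun i => ρ (H i) + δ) (fun i => by have := hρ.nonneg (H i); linarith)
    fun i => by linarith

end

/-! ### The gauge of a tuple in a complex quasi-Banach lattice -/

section

variable {L : Type*} [AddCommGroup L] [Module ℝ L] [Lattice L] [QuasiBanachLattice L]

theorem isKrivineCalculus_krivine {n : ℕ} (y : Fin n → L) :
    IsKrivineCalculus y fun f => krivine f y :=
  (Krivine.exists_calculus y).choose_spec

theorem IsContHomog.comp {m n : ℕ} {f : (Fin m → ℝ) → ℝ} {h : Fin m → (Fin n → ℝ) → ℝ}
    (hf : IsContHomog f) (hh : ∀ j, IsContHomog (h j)) : IsContHomog fun t => f fun j => h j t := by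
  refine ⟨hf.1.comp (continuous_pi fun j => (hh j).1), fun c t hc => ?_⟩
  have : (fun j => h j (c • t)) = c • fun j => h j t := funext fun j => (hh j).2 c t hc
  simp only [this, hf.2 c _ hc]

/-- Substitution in the functional calculus, by uniqueness. -/
theorem krivine_comp {m n : ℕ} {f : (Fin m → ℝ) → ℝ} {h : Fin m → (Fin n → ℝ) → ℝ}
    (hf : IsContHomog f) (hh : ∀ j, IsContHomog (h j)) (y : Fin n → L) :
    krivine f (fun j => krivine (h j) y) = krivine (fun t => f fun j => h j t) y := by
  have hy := isKrivineCalculus_krivine y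
  have hΨ : IsKrivineCalculus (fun j => krivine (h j) y)
      fun f => krivine (fun t => f fun j => h j t) y :=
    ⟨fun _ => rfl, fun f g hf hg => hy.add _ _ (hf.comp hh) (hg.comp hh),
      fun c f hf => hy.smul c _ (hf.comp hh), fun f g hf hg => hy.sup _ _ (hf.comp hh) (hg.comp hh)⟩
  exact Krivine.calculus_unique (isKrivineCalculus_krivine _) hΨ hf

theorem krivine_mono {n : ℕ} {f g : (Fin n → ℝ) → ℝ} (hf : IsContHomog f) (hg : IsContHomog g)
    (hfg : f ≤ g) (y : Fin n → L) : krivine f y ≤ krivine g y := by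
  have := (isKrivineCalculus_krivine y).sup f g hf hg
  rw [sup_eq_right.2 hfg] at this
  rw [this]
  exact le_sup_left

theorem isContHomog_sum {n : ℕ} {ι : Type*} (s : Finset ι) (a : ι → ℝ) (k : ι → Fin n) :
    IsContHomog fun t : Fin n → ℝ => ∑ i ∈ s, a i * t (k i) := by
  refine ⟨by fun_prop, fun c t _ => ?_⟩
  simp only [Pi.smul_apply, smul_eq_mul, Finset.mul_sum]
  exact Finset.sum_congr rfl fun k _ => by ring

theorem krivine_zero {n : ℕ} (y : Fin n → L) : krivine (fun _ => 0) y = 0 := by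
  have h0 : IsContHomog fun _ : Fin n → ℝ => (0 : ℝ) := ⟨continuous_const, fun c t _ => by simp⟩
  have := (isKrivineCalculus_krivine y).smul 0 _ h0
  rwa [zero_smul, zero_smul] at this

theorem krivine_sum {n : ℕ} (a : Fin n → ℝ) (y : Fin n → L) :
    krivine (fun t => ∑ k, a k * t k) y = ∑ k, a k • y k := by
  have hy := isKrivineCalculus_krivine y
  have hcoord : ∀ k : Fin n, IsContHomog fun t : Fin n → ℝ => t k := fun k =>
    ⟨continuous_apply k, fun _ _ _ => rfl⟩
  have hsm : ∀ k : Fin n, IsContHomog (a k • fun t : Fin n → ℝ => t k) := fun k =>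
    ⟨(hcoord k).1.const_smul _, fun c t _ => by simp only [Pi.smul_apply, smul_eq_mul]; ring⟩
  suffices h : ∀ s : Finset (Fin n), krivine (fun t => ∑ k ∈ s, a k * t k) y = ∑ k ∈ s, a k • y k
    from h Finset.univ
  intro s
  induction s using Finset.cons_induction with
  | empty => simpa using krivine_zero y
  | cons k s hk ih =>
    simp only [Finset.sum_cons]
    rw [← ih]
    refine (hy.add _ _ (hsm k) (isContHomog_sum s a id)).trans ?_
    have := hy.smul (a k) _ (hcoord k)
    rw [hy.coord] at this
    exact congrArg (· + _) this

/-- The real and imaginary parts of a tuple in the complexification, as one tuple in `L`. -/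
def realCoords {n : ℕ} (x : Fin n → Complexification L) : Fin (n + n) → L :=
  Fin.append (fun k => (x k).re) fun k => (x k).im

/-- The identification of `ℝ²ⁿ` with `ℂⁿ` that matches `realCoords`. -/
def toComplexTuple {n : ℕ} (t : Fin (n + n) → ℝ) : Fin n → ℂ :=
  fun k => ⟨t (Fin.castAdd n k), t (Fin.natAdd n k)⟩

/-- The gauge `H ↦ ‖H(x₁, …, xₙ)‖` of a tuple in the complexification of `L`. -/
noncomputable def krivineGauge {n : ℕ} (x : Fin n → Complexification L) (H : (Fin n → ℂ) → ℝ) : ℝ :=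
  lnorm (krivine (fun t => H (toComplexTuple t)) (realCoords x))

theorem IsNonnegHomog.isContHomog {n : ℕ} {H : (Fin n → ℂ) → ℝ} (hH : IsNonnegHomog H) :
    IsContHomog fun t => H (toComplexTuple t) := by
  refine ⟨hH.cont.comp (continuous_pi fun k => ?_), fun c t hc => ?_⟩
  · have : (fun t : Fin (n + n) → ℝ => toComplexTuple t k) = fun t =>
        (t (Fin.castAdd n k) : ℂ) + t (Fin.natAdd n k) * Complex.I := by
      funext t
      exact Complex.mk_eq_add_mul_I _ _
    rw [this]
    fun_prop
  · have : toComplexTuple (c • t) = c • toComplexTuple t := by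
      funext k
      apply Complex.ext <;> simp [toComplexTuple]
    dsimp only
    rw [this, hH.homog c _ hc]

theorem krivine_nonneg {n : ℕ} {H : (Fin n → ℂ) → ℝ} (hH : IsNonnegHomog H)
    (y : Fin (n + n) → L) : 0 ≤ krivine (fun t => H (toComplexTuple t)) y := by
  rw [← krivine_zero y]
  exact krivine_mono ⟨continuous_const, fun c t _ => by simp⟩ hH.isContHomog
    (fun t => hH.nonneg _) y

theorem isContHomog_modulus : IsContHomog fun t : Fin 2 → ℝ => √(t 0 ^ 2 + t 1 ^ 2) := by
  refine ⟨by fun_prop, fun c t hc => ?_⟩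
  simp only [Pi.smul_apply, smul_eq_mul, mul_pow, ← mul_add]
  rw [Real.sqrt_mul (sq_nonneg c), Real.sqrt_sq hc]

theorem modulus_krivine {n : ℕ} {h : Fin 2 → (Fin n → ℝ) → ℝ} (hh : ∀ j, IsContHomog (h j))
    (y : Fin n → L) {z : Complexification L} (hre : z.re = krivine (h 0) y)
    (him : z.im = krivine (h 1) y) :
    z.modulus = krivine (fun t => √(h 0 t ^ 2 + h 1 t ^ 2)) y := by
  have e : ![z.re, z.im] = fun j => krivine (h j) y := by
    funext j
    fin_cases j
    exacts [hre, him]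
  rw [Complexification.modulus, e, krivine_comp isContHomog_modulus hh]

theorem re_sum {n : ℕ} (z : Fin n → Complexification L) :
    (∑ k, z k).re = ∑ k, (z k).re :=
  map_sum (AddMonoidHom.fst L L) z Finset.univ

theorem im_sum {n : ℕ} (z : Fin n → Complexification L) :
    (∑ k, z k).im = ∑ k, (z k).im :=
  map_sum (AddMonoidHom.snd L L) z Finset.univ

/-- The gauge of a tuple computes the quasinorms of its linear combinations. -/
theorem cnorm_sum_smul {n : ℕ} (a : Fin n → ℂ) (x : Fin n → Complexification L) :
    (∑ k, a k • x k).cnorm = krivineGauge x (linAbs a) := by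
  let p : Fin (n + n) → ℝ := Fin.append (fun k => (a k).re) fun k => -(a k).im
  let p' : Fin (n + n) → ℝ := Fin.append (fun k => (a k).im) fun k => (a k).re
  let h : Fin 2 → (Fin (n + n) → ℝ) → ℝ := ![fun t => ∑ k, p k * t k, fun t => ∑ k, p' k * t k]
  have hh : ∀ j, IsContHomog (h j) := by
    intro j
    fin_cases j <;> exact isContHomog_sum Finset.univ _ id
  have hre : (∑ k, a k • x k).re = krivine (h 0) (realCoords x) := by
    refine (re_sum _).trans ((krivine_sum p (realCoords x)).trans ?_).symm
    simp only [p, realCoords, Fin.sum_univ_add, Fin.append_left, Fin.append_right,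
      ← Finset.sum_add_distrib]
    refine Finset.sum_congr rfl fun k _ => ?_
    change _ = (a k).re • (x k).re - (a k).im • (x k).im
    rw [neg_smul, sub_eq_add_neg]
  have him : (∑ k, a k • x k).im = krivine (h 1) (realCoords x) := by
    refine (im_sum _).trans ((krivine_sum p' (realCoords x)).trans ?_).symm
    simp only [p', realCoords, Fin.sum_univ_add, Fin.append_left, Fin.append_right,
      ← Finset.sum_add_distrib]
    refine Finset.sum_congr rfl fun k _ => ?_
    change _ = (a k).re • (x k).im + (a k).im • (x k).re
    rw [add_comm]
  rw [Complexification.cnorm, modulus_krivine hh _ hre him, krivineGauge]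
  congr 2
  funext t
  rw [linAbs, Complex.norm_eq_sqrt_sq_add_sq, Complex.re_sum, Complex.im_sum]
  change √((∑ k, p k * t k) ^ 2 + (∑ k, p' k * t k) ^ 2) = _
  simp only [p, p', Fin.sum_univ_add, Fin.append_left, Fin.append_right,
    ← Finset.sum_add_distrib, Complex.mul_re, Complex.mul_im, toComplexTuple, neg_mul,
    ← sub_eq_add_neg]
  congr 3
  exact Finset.sum_congr rfl fun k _ => add_comm _ _

theorem isContHomog_sum_rpow {m : ℕ} {q : ℝ} (hq : 0 < q) :
    IsContHomog fun t : Fin m → ℝ => (∑ k, |t k| ^ q) ^ (1 / q) := by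
  have hk : ∀ k : Fin m, IsNonnegHomog fun t : Fin m → ℝ => |t k| := fun k =>
    ⟨by fun_prop, fun t => abs_nonneg _, fun c t hc => by simp [abs_mul, abs_of_nonneg hc]⟩
  have := IsNonnegHomog.sum_rpow hk hq
  exact ⟨this.cont, this.homog⟩

theorem isConvexGauge_krivineGauge {q C : ℝ} (hq : 0 < q) (hC : 1 ≤ C)
    (hL : ∀ (n : ℕ) (y : Fin n → Complexification L),
      lnorm (krivine (fun t : Fin n → ℝ => (∑ k, |t k| ^ q) ^ (1 / q)) fun k => (y k).modulus) ≤
        C * (∑ k, (y k).cnorm ^ q) ^ (1 / q))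
    {n : ℕ} (x : Fin n → Complexification L) : IsConvexGauge q (C ^ q) (krivineGauge x) := by
  refine ⟨fun H => QuasiBanachSpace.qnorm_nonneg _, fun H₁ H₂ h₁ h₂ h => ?_, fun c H hc hH => ?_,
    fun m H₀ H h₀ hH h => ?_⟩
  · exact Krivine.lnorm_mono (krivine_nonneg h₁ _)
      (krivine_mono h₁.isContHomog h₂.isContHomog (fun t => h _) _)
  · have := (isKrivineCalculus_krivine (realCoords x)).smul c _ hH.isContHomog
    refine (congrArg lnorm this).trans ((QuasiBanachSpace.qnorm_smul _ _).trans ?_)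
    rw [Real.norm_of_nonneg hc]
    rfl
  · let y : Fin m → Complexification L := fun i =>
      (krivine (fun t => H i (toComplexTuple t)) (realCoords x), 0)
    have hy : ∀ i, (y i).modulus = krivine (fun t => H i (toComplexTuple t)) (realCoords x) := by
      intro i
      rw [modulus_krivine (h := ![fun t => H i (toComplexTuple t), fun _ => 0])
        (y := realCoords x) ?_ rfl (krivine_zero _).symm]
      · congr 1
        funext t
        simp [Real.sqrt_sq ((hH i).nonneg _)]
      · intro j
        fin_cases j
        exacts [(hH i).isContHomog, ⟨continuous_const, fun c t _ => by simp⟩]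
    have h1 := hL m y
    simp only [Complexification.cnorm, hy] at h1
    rw [krivine_comp (isContHomog_sum_rpow hq) fun i => (hH i).isContHomog] at h1
    simp only [abs_of_nonneg ((hH _).nonneg _)] at h1
    have h2 : krivineGauge x H₀ ≤ C * (∑ i, krivineGauge x (H i) ^ q) ^ (1 / q) := by
      refine le_trans (Krivine.lnorm_mono (krivine_nonneg h₀ _) (krivine_mono h₀.isContHomog
        (IsNonnegHomog.sum_rpow hH hq).isContHomog (fun t => ?_) _)) h1
      change H₀ _ ≤ _
      rw [one_div, Real.le_rpow_inv_iff_of_pos (h₀.nonneg _)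
        (Finset.sum_nonneg fun i _ => Real.rpow_nonneg ((hH i).nonneg _) _) hq]
      exact h _
    have hS : 0 ≤ ∑ i, krivineGauge x (H i) ^ q :=
      Finset.sum_nonneg fun i _ => Real.rpow_nonneg (QuasiBanachSpace.qnorm_nonneg _) _
    refine (Real.rpow_le_rpow (QuasiBanachSpace.qnorm_nonneg _) h2 hq.le).trans (le_of_eq ?_)
    rw [Real.mul_rpow (by linarith) (Real.rpow_nonneg hS _), ← Real.rpow_mul hS,
      one_div_mul_cancel hq.ne', Real.rpow_one]

/-- The `r`-norm inequality of the lattice, for its gauges. -/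
theorem krivineGauge_rpow_le {n : ℕ} (x : Fin n → Complexification L) {r : ℝ} (hr : 0 < r)
    (hL : ∀ u v : L, lnorm (u + v) ^ r ≤ lnorm u ^ r + lnorm v ^ r) {H₀ H₁ H₂ : (Fin n → ℂ) → ℝ}
    (h₀ : IsNonnegHomog H₀) (h₁ : IsNonnegHomog H₁) (h₂ : IsNonnegHomog H₂)
    (h : ∀ t, H₀ t ≤ H₁ t + H₂ t) :
    krivineGauge x H₀ ^ r ≤ krivineGauge x H₁ ^ r + krivineGauge x H₂ ^ r := by
  have hadd := (isKrivineCalculus_krivine (realCoords x)).add _ _ h₁.isContHomog h₂.isContHomog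
  refine le_trans (Real.rpow_le_rpow (QuasiBanachSpace.qnorm_nonneg _) ?_ hr.le) (hL _ _)
  rw [← hadd]
  refine Krivine.lnorm_mono (krivine_nonneg h₀ _) (krivine_mono h₀.isContHomog
    ⟨h₁.isContHomog.1.add h₂.isContHomog.1, fun c t hc => ?_⟩ (fun t => h _) _)
  have e1 := h₁.isContHomog.2 c t hc
  have e2 := h₂.isContHomog.2 c t hc
  dsimp only at e1 e2
  simp only [Pi.add_apply, e1, e2, mul_add]

end

/-! ### `L_p`-averages of gauges -/

section

variable {n : ℕ} {ρ : ((Fin n → ℂ) → ℝ) → ℝ} {s K r : ℝ}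

theorem IsNonnegHomog.comp_mul {H : (Fin n → ℂ) → ℝ} (hH : IsNonnegHomog H) (c : Fin n → ℂ) :
    IsNonnegHomog fun t => H (c * t) :=
  ⟨hH.cont.comp (continuous_const.mul continuous_id), fun t => hH.nonneg _, fun a t ha => by
    rw [mul_smul_comm, hH.homog a _ ha]⟩

theorem isNonnegHomog_norm : IsNonnegHomog fun t : Fin n → ℂ => ‖t‖ :=
  ⟨continuous_norm, norm_nonneg, fun c t hc => by rw [norm_smul, Real.norm_of_nonneg hc]⟩

/-- By homogeneity, uniform convergence on the unit ball gives convergence relative to `‖t‖`. -/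
theorem IsNonnegHomog.eventually_abs_sub_le {H : (Fin n → ℂ) → ℝ} (hH : IsNonnegHomog H)
    (c₀ : Fin n → ℂ) {ε : ℝ} (hε : 0 < ε) :
    ∀ᶠ c in 𝓝 c₀, ∀ t, |H (c * t) - H (c₀ * t)| ≤ ε * ‖t‖ := by
  let B : Set (Fin n → ℂ) := Metric.closedBall 0 1
  have : CompactSpace B := isCompact_iff_compactSpace.1 (isCompact_closedBall 0 1)
  let F : C((Fin n → ℂ) × B, ℝ) := ⟨fun x => H (x.1 * x.2.1), hH.cont.comp (by fun_prop)⟩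
  have hF := F.curry.continuous.tendsto c₀
  filter_upwards [Metric.tendsto_nhds.1 hF ε hε] with c hc t
  rcases eq_or_ne t 0 with rfl | ht
  · simp
  have ht0 : 0 < ‖t‖ := norm_pos_iff.2 ht
  have hB : ‖t‖⁻¹ • t ∈ B := by
    simp only [B, mem_closedBall_zero_iff, norm_smul, norm_inv, norm_norm]
    rw [inv_mul_cancel₀ ht0.ne']
  have h1 := (ContinuousMap.dist_apply_le_dist (f := F.curry c) (g := F.curry c₀) ⟨_, hB⟩).trans
    hc.le
  rw [Real.dist_eq] at h1
  change |H (c * (‖t‖⁻¹ • t)) - H (c₀ * (‖t‖⁻¹ • t))| ≤ ε at h1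
  rw [mul_smul_comm, mul_smul_comm, hH.homog _ _ (by positivity), hH.homog _ _ (by positivity),
    ← mul_sub, abs_mul, abs_of_pos (by positivity), inv_mul_le_iff₀ ht0, mul_comm ‖t‖] at h1
  exact h1

/-- Convexity alone bounds a gauge only up to the constant `K`; continuity comes from the additional
`r`-norm inequality `hadd`. -/
theorem IsConvexGauge.continuous_comp_mul (hρ : IsConvexGauge s K ρ) (hr : 0 < r)
    (hadd : ∀ H₀ H₁ H₂ : (Fin n → ℂ) → ℝ, IsNonnegHomog H₀ → IsNonnegHomog H₁ → IsNonnegHomog H₂ →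
      (∀ t, H₀ t ≤ H₁ t + H₂ t) → ρ H₀ ^ r ≤ ρ H₁ ^ r + ρ H₂ ^ r)
    {H : (Fin n → ℂ) → ℝ} (hH : IsNonnegHomog H) :
    Continuous fun c : Fin n → ℂ => ρ fun t => H (c * t) := by
  have hcont : Continuous fun c : Fin n → ℂ => (ρ fun t => H (c * t)) ^ r := by
    rw [continuous_iff_continuousAt]
    intro c₀
    rw [ContinuousAt, Metric.tendsto_nhds]
    intro ε hε
    set U := ρ fun t => ‖t‖ with hU
    have hU0 : 0 ≤ U := hρ.nonneg _
    obtain ⟨δ, hδ, hδε⟩ : ∃ δ : ℝ, 0 < δ ∧ (δ * U) ^ r < ε := by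
      have h : Tendsto (fun δ : ℝ => (δ * U) ^ r) (𝓝[>] 0) (𝓝 ((0 * U) ^ r)) :=
        ((continuous_id.mul continuous_const).rpow_const fun _ => Or.inr hr.le).tendsto 0
          |>.mono_left nhdsWithin_le_nhds
      rw [zero_mul, Real.zero_rpow hr.ne'] at h
      obtain ⟨δ, h1, h2⟩ := ((h.eventually_lt_const hε).and self_mem_nhdsWithin).exists
      exact ⟨δ, h2, h1⟩
    filter_upwards [hH.eventually_abs_sub_le c₀ hδ] with c hc
    have hδU : ρ (fun t => δ * ‖t‖) = δ * U := hρ.smul _ _ hδ.le isNonnegHomog_norm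
    have h1 := hadd _ _ _ (hH.comp_mul c) (hH.comp_mul c₀) (isNonnegHomog_norm.const_mul hδ.le)
      fun t => by linarith [(abs_le.1 (hc t)).2]
    have h2 := hadd _ _ _ (hH.comp_mul c₀) (hH.comp_mul c) (isNonnegHomog_norm.const_mul hδ.le)
      fun t => by linarith [(abs_le.1 (hc t)).1]
    rw [hδU] at h1 h2
    rw [Real.dist_eq, abs_lt]
    constructor <;> linarith
  have e : (fun c : Fin n → ℂ => ρ fun t => H (c * t)) =
      fun c : Fin n → ℂ => ((ρ fun t => H (c * t)) ^ r) ^ (1 / r) := by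
    funext c
    rw [← Real.rpow_mul (hρ.nonneg _), mul_one_div_cancel hr.ne', Real.rpow_one]
  rw [e]
  exact hcont.rpow_const fun _ => Or.inr (by positivity)

variable {G : Type*} [TopologicalSpace G] [CompactSpace G] [MeasurableSpace G] [BorelSpace G]
  {μ : Measure G} [IsFiniteMeasure μ]

theorem memLp_of_continuous (p : ℝ≥0∞) {f : G → ℝ} (hf : Continuous f) : MemLp f p μ := by
  obtain ⟨C, hC⟩ := (isCompact_range hf).isBounded.exists_norm_le
  exact MemLp.of_bound hf.aestronglyMeasurable C (ae_of_all _ fun g => hC _ ⟨g, rfl⟩)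

/-- The gauge `H ↦ ‖ρ(H(φ₁(g) t₁, …, φₙ(g) tₙ))‖_{L_p(dg)}`. -/
noncomputable def lpGauge (p : ℝ≥0∞) (μ : Measure G) (φ : G → Fin n → ℂ)
    (ρ : ((Fin n → ℂ) → ℝ) → ℝ) (H : (Fin n → ℂ) → ℝ) : ℝ :=
  (eLpNorm (fun g => ρ fun t => H (φ g * t)) p μ).toReal

/-- The `L_p` average of an `s`-convex gauge is `s`-convex when `s ≤ p`, by the triangle inequality
in `L_{p/s}`. -/
theorem isConvexGauge_lpGauge (hρ : IsConvexGauge s K ρ) (hs : 0 < s) (hK : 0 ≤ K) (hr : 0 < r)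
    (hadd : ∀ H₀ H₁ H₂ : (Fin n → ℂ) → ℝ, IsNonnegHomog H₀ → IsNonnegHomog H₁ → IsNonnegHomog H₂ →
      (∀ t, H₀ t ≤ H₁ t + H₂ t) → ρ H₀ ^ r ≤ ρ H₁ ^ r + ρ H₂ ^ r)
    {p : ℝ≥0∞} (hp : ENNReal.ofReal s ≤ p) {φ : G → Fin n → ℂ} (hφ : Continuous φ) :
    IsConvexGauge s K (lpGauge p μ φ ρ) := by
  have hcont : ∀ H, IsNonnegHomog H → Continuous fun g => ρ fun t => H (φ g * t) := fun H hH =>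
    (hρ.continuous_comp_mul hr hadd hH).comp hφ
  have hfin : ∀ H, IsNonnegHomog H → eLpNorm (fun g => ρ fun t => H (φ g * t)) p μ ≠ ∞ :=
    fun H hH => (memLp_of_continuous p (hcont H hH)).eLpNorm_ne_top
  refine ⟨fun H => ENNReal.toReal_nonneg, fun H₁ H₂ h₁ h₂ h => ?_, fun c H hc hH => ?_,
    fun m H₀ H h₀ hH h => ?_⟩
  · refine ENNReal.toReal_mono (hfin _ h₂) (eLpNorm_mono_real fun g => ?_)
    rw [Real.norm_of_nonneg (hρ.nonneg _)]
    exact hρ.mono _ _ (h₁.comp_mul _) (h₂.comp_mul _) fun t => h _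
  · have e : (fun g => ρ fun t => c * H (φ g * t)) = c • fun g => ρ fun t => H (φ g * t) := by
      funext g
      exact hρ.smul _ _ hc (hH.comp_mul _)
    rw [lpGauge, e, eLpNorm_const_smul, ENNReal.toReal_mul, toReal_enorm, Real.norm_of_nonneg hc,
      lpGauge]
  · have hs' : ENNReal.ofReal s ≠ 0 := (ENNReal.ofReal_pos.2 hs).ne'
    have hp1 : 1 ≤ p / ENNReal.ofReal s := by
      rw [ENNReal.le_div_iff_mul_le (Or.inl hs') (Or.inl ENNReal.ofReal_ne_top), one_mul]
      exact hp
    have hpow : ∀ H : (Fin n → ℂ) → ℝ,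
        eLpNorm (fun g => (ρ fun t => H (φ g * t)) ^ s) (p / ENNReal.ofReal s) μ =
          eLpNorm (fun g => ρ fun t => H (φ g * t)) p μ ^ s := fun H => by
      have := eLpNorm_norm_rpow (fun g => ρ fun t => H (φ g * t)) (μ := μ)
        (p := p / ENNReal.ofReal s) hs
      rw [ENNReal.div_mul_cancel hs' ENNReal.ofReal_ne_top] at this
      rw [← this]
      congr 1
      funext g
      rw [Real.norm_of_nonneg (hρ.nonneg _)]
    have h1 : eLpNorm (fun g => (ρ fun t => H₀ (φ g * t)) ^ s) (p / ENNReal.ofReal s) μ ≤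
        eLpNorm (K • ∑ i, fun g => (ρ fun t => H i (φ g * t)) ^ s) (p / ENNReal.ofReal s) μ := by
      refine eLpNorm_mono_real fun g => ?_
      rw [Real.norm_of_nonneg (Real.rpow_nonneg (hρ.nonneg _) _)]
      simp only [Pi.smul_apply, Finset.sum_apply, smul_eq_mul]
      exact hρ.conv _ _ _ (h₀.comp_mul _) (fun i => (hH i).comp_mul _) fun t => h _
    have h2 := eLpNorm_sum_le (μ := μ) (p := p / ENNReal.ofReal s) (s := Finset.univ)
      (f := fun i g => (ρ fun t => H i (φ g * t)) ^ s)
      (fun i _ => ((hcont _ (hH i)).rpow_const fun _ => Or.inr hs.le).aestronglyMeasurable) hp1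
    rw [eLpNorm_const_smul] at h1
    simp only [hpow] at h1 h2
    have h3 := h1.trans (mul_le_mul_right h2 _)
    have hfin' : ∀ i, eLpNorm (fun g => ρ fun t => H i (φ g * t)) p μ ^ s ≠ ∞ := fun i =>
      ENNReal.rpow_ne_top_of_nonneg hs.le (hfin _ (hH i))
    have h4 := ENNReal.toReal_mono (ENNReal.mul_ne_top enorm_ne_top
      (ENNReal.sum_ne_top.2 fun i _ => hfin' i)) h3
    rw [ENNReal.toReal_mul, toReal_enorm, Real.norm_of_nonneg hK, ENNReal.toReal_sum
      fun i _ => hfin' i] at h4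
    simp only [← ENNReal.toReal_rpow] at h4
    exact h4

end

/-! ### Convex hulls of the orbits of a Sidon set -/

/-- The dual form of the Sidon property: by the Hahn-Banach theorem, the closed convex hull of the
points `M z φ(g)` with `|z| = 1` contains the unit ball of `ℓ_∞ⁿ`. -/
theorem mem_closure_convexHull_of_sidon {G : Type*} [Nonempty G] {n : ℕ} {φ : G → Fin n → ℂ}
    {M : ℝ} (hM : 0 < M)
    (hS : ∀ β : Fin n → ℂ, ∑ k, ‖β k‖ ≤ M * ⨆ g, ‖∑ k, β k * φ g k‖)
    {a : Fin n → ℂ} (ha : ∀ k, ‖a k‖ ≤ 1) :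
    a ∈ closure (convexHull ℝ {v | ∃ (g : G) (z : ℂ), ‖z‖ = 1 ∧ v = (M : ℂ) • z • φ g}) := by
  by_contra hcon
  obtain ⟨f, u, hu, hua⟩ := geometric_hahn_banach_closed_point
    (convex_convexHull ℝ _).closure isClosed_closure hcon
  let β : Fin n → ℂ := fun k => ⟨f (Pi.single k 1), -f (Pi.single k Complex.I)⟩
  have hf : ∀ v, f v = (∑ k, β k * v k).re := by
    intro v
    conv_lhs => rw [← Finset.univ_sum_single v, map_sum]
    rw [Complex.re_sum]
    refine Finset.sum_congr rfl fun k _ => ?_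
    have e : (Pi.single k (v k) : Fin n → ℂ) =
        (v k).re • (Pi.single k 1 : Fin n → ℂ) +
          (v k).im • (Pi.single k Complex.I : Fin n → ℂ) := by
      rw [← Pi.single_smul, ← Pi.single_smul, ← Pi.single_add]
      congr 1
      rw [Complex.real_smul, Complex.real_smul, mul_one, Complex.re_add_im]
    rw [e, map_add, map_smul, map_smul, Complex.mul_re]
    simp only [β, smul_eq_mul]
    ring
  have hle : ∀ g, ‖∑ k, β k * φ g k‖ ≤ u / M := by
    intro g
    set w := ∑ k, β k * φ g k with hw
    obtain ⟨z, hz, hzw⟩ : ∃ z : ℂ, ‖z‖ = 1 ∧ z * w = ‖w‖ := by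
      rcases eq_or_ne w 0 with h | h
      · exact ⟨1, by simp, by simp [h]⟩
      · have hw0 : (‖w‖ : ℂ) ≠ 0 := by exact_mod_cast norm_ne_zero_iff.2 h
        refine ⟨(starRingEnd ℂ) w / ‖w‖, ?_, ?_⟩
        · rw [norm_div, RCLike.norm_conj, Complex.norm_real, norm_norm,
            div_self (norm_ne_zero_iff.2 h)]
        · rw [div_mul_eq_mul_div, Complex.conj_mul', pow_two, mul_div_cancel_right₀ _ hw0]
    have h1 := hu _ (subset_closure (subset_convexHull ℝ _ ⟨g, z, hz, rfl⟩))
    have e : ∑ k, β k * ((M : ℂ) • z • φ g) k = (M : ℂ) * (z * w) := by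
      rw [hw, Finset.mul_sum, Finset.mul_sum]
      refine Finset.sum_congr rfl fun k _ => ?_
      simp only [Pi.smul_apply, smul_eq_mul]
      ring
    rw [hf, e, hzw, ← Complex.ofReal_mul, Complex.ofReal_re] at h1
    rw [le_div_iff₀ hM, mul_comm]
    exact h1.le
  have h1 : ∑ k, ‖β k‖ ≤ u := by
    refine (hS β).trans ((mul_le_mul_of_nonneg_left (ciSup_le hle) hM.le).trans (le_of_eq ?_))
    field_simp
  have h2 : f a ≤ ∑ k, ‖β k‖ := by
    rw [hf]
    refine (Complex.re_le_norm _).trans ((norm_sum_le _ _).trans (Finset.sum_le_sum fun k _ => ?_))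
    rw [norm_mul]
    exact mul_le_of_le_one_right (norm_nonneg _) (ha k)
  linarith

/-! ### Unimodular multipliers for natural spaces -/

section

variable {X : Type*} [AddCommGroup X] [Module ℂ X] [QuasiBanachSpace ℂ X]

theorem continuous_qnorm_sum {n : ℕ} (x : Fin n → X) :
    Continuous fun c : Fin n → ℂ => QuasiBanachSpace.qnorm ℂ (∑ k, c k • x k) := by
  obtain ⟨r, hr, -, hadd⟩ := QuasiBanachSpace.exists_rnorm (𝕜 := ℂ) (X := X)
  have hnn : ∀ y : X, 0 ≤ QuasiBanachSpace.qnorm ℂ y := QuasiBanachSpace.qnorm_nonneg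
  have h0 : QuasiBanachSpace.qnorm ℂ (0 : X) = 0 := by
    simpa using QuasiBanachSpace.qnorm_smul (0 : ℂ) (0 : X)
  have hsum : ∀ (s : Finset (Fin n)) (c : Fin n → ℂ),
      QuasiBanachSpace.qnorm ℂ (∑ k ∈ s, c k • x k) ^ r ≤
        ∑ k ∈ s, (‖c k‖ * QuasiBanachSpace.qnorm ℂ (x k)) ^ r := by
    intro s c
    induction s using Finset.cons_induction with
    | empty => simp [h0, Real.zero_rpow hr.ne']
    | cons k s hk ih =>
      rw [Finset.sum_cons, Finset.sum_cons, ← QuasiBanachSpace.qnorm_smul]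
      exact (hadd _ _).trans (add_le_add_right ih _)
  have hle : ∀ c c' : Fin n → ℂ, QuasiBanachSpace.qnorm ℂ (∑ k, c k • x k) ^ r ≤
      QuasiBanachSpace.qnorm ℂ (∑ k, c' k • x k) ^ r +
        ∑ k, (‖c k - c' k‖ * QuasiBanachSpace.qnorm ℂ (x k)) ^ r := by
    intro c c'
    have e : ∑ k, c k • x k = ∑ k, c' k • x k + ∑ k, (c - c') k • x k := by
      rw [← Finset.sum_add_distrib]
      exact Finset.sum_congr rfl fun k _ => by rw [Pi.sub_apply, sub_smul]; abel
    rw [e]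
    exact (hadd _ _).trans (add_le_add_right (hsum Finset.univ _) _)
  have hcont : Continuous fun c : Fin n → ℂ => QuasiBanachSpace.qnorm ℂ (∑ k, c k • x k) ^ r := by
    rw [continuous_iff_continuousAt]
    intro c₀
    rw [ContinuousAt, tendsto_iff_dist_tendsto_zero]
    have hlim : Tendsto (fun c : Fin n → ℂ =>
        ∑ k, (‖c k - c₀ k‖ * QuasiBanachSpace.qnorm ℂ (x k)) ^ r) (𝓝 c₀) (𝓝 0) := by
      have hc : Continuous fun c : Fin n → ℂ =>
          ∑ k, (‖c k - c₀ k‖ * QuasiBanachSpace.qnorm ℂ (x k)) ^ r :=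
        continuous_finsetSum _ fun k _ => Continuous.rpow_const (by fun_prop) fun _ => Or.inr hr.le
      simpa [Real.zero_rpow hr.ne'] using hc.tendsto c₀
    refine squeeze_zero (fun _ => dist_nonneg) (fun c => ?_) hlim
    have h1 := hle c c₀
    have h2 := hle c₀ c
    simp only [norm_sub_rev (c₀ _)] at h2
    rw [Real.dist_eq, abs_le]
    constructor <;> linarith
  have e : (fun c : Fin n → ℂ => QuasiBanachSpace.qnorm ℂ (∑ k, c k • x k)) =
      fun c => (QuasiBanachSpace.qnorm ℂ (∑ k, c k • x k) ^ r) ^ (1 / r) := by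
    funext c
    rw [← Real.rpow_mul (hnn _), mul_one_div_cancel hr.ne', Real.rpow_one]
  rw [e]
  exact hcont.rpow_const fun _ => Or.inr (by positivity)

end

section

variable {G : Type*} [Group G] [TopologicalSpace G] [IsTopologicalGroup G] [CompactSpace G]
  [MeasurableSpace G] [BorelSpace G]

instance : IsProbabilityMeasure (haarProb G) :=
  ⟨Measure.haarMeasure_self⟩

instance : (haarProb G).IsHaarMeasure :=
  inferInstanceAs (Measure.haarMeasure _).IsHaarMeasure

end

section

variable {G : Type*} [CommGroup G] [TopologicalSpace G] [IsTopologicalGroup G] [CompactSpace G]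
  [MeasurableSpace G] [BorelSpace G]

/-- On a natural space, the orbit `g ↦ ∑ φ_k(g) x_k` of a system of characters `φ` with Sidon
constant `M` admits all multipliers of modulus at most one, with a bound that depends on `M`, `p`
and `X` only. -/
theorem exists_multiplier_bound {X : Type u} [AddCommGroup X] [Module ℂ X] [QuasiBanachSpace ℂ X]
    (hX : IsNatural.{u, v} X) {p : ℝ≥0∞} (hp : 0 < p) {M : ℝ} (hM : 0 < M) :
    ∃ C : ℝ≥0, 1 ≤ C ∧ ∀ (n : ℕ) (φ : G → Fin n → ℂ), Continuous φ →
      (∀ g h, φ (g * h) = φ g * φ h) → (∀ g k, ‖φ g k‖ = 1) →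
      (∀ β : Fin n → ℂ, ∑ k, ‖β k‖ ≤ M * ⨆ g, ‖∑ k, β k * φ g k‖) →
      ∀ (x : Fin n → X) (a : Fin n → ℂ), (∀ k, ‖a k‖ ≤ 1) →
        lpQNorm p (fun g => ∑ k, (a k * φ g k) • x k) ≤
          C * lpQNorm p (fun g => ∑ k, φ g k • x k) := by
  obtain ⟨L, _, _, _, _, ⟨q, hq, C₀, hL⟩, T, α, b, hα, hb, hT⟩ := hX
  obtain ⟨r, hr, -, hadd⟩ := QuasiBanachSpace.exists_rnorm (𝕜 := ℝ) (X := L)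
  obtain ⟨s, hs, hs1, hsq, hsp⟩ : ∃ s : ℝ, 0 < s ∧ s ≤ 1 ∧ s ≤ q ∧ ENNReal.ofReal s ≤ p := by
    obtain ⟨p', hp', hp'p⟩ : ∃ p' : ℝ, 0 < p' ∧ ENNReal.ofReal p' ≤ p := by
      rcases eq_or_ne p ∞ with rfl | h
      · exact ⟨1, one_pos, le_top⟩
      · exact ⟨p.toReal, ENNReal.toReal_pos hp.ne' h, (ENNReal.ofReal_toReal h).le⟩
    exact ⟨min (min 1 q) p', by positivity, (min_le_left _ _).trans (min_le_left _ _),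
      (min_le_left _ _).trans (min_le_right _ _),
      (ENNReal.ofReal_le_ofReal (min_le_right _ _)).trans hp'p⟩
  set C₁ := max C₀ 1 with hC₁
  have hC₁1 : 1 ≤ C₁ := le_max_right _ _
  have hL' : ∀ (n : ℕ) (y : Fin n → Complexification L),
      lnorm (krivine (fun t : Fin n → ℝ => (∑ k, |t k| ^ q) ^ (1 / q)) fun k => (y k).modulus) ≤
        C₁ * (∑ k, (y k).cnorm ^ q) ^ (1 / q) := fun n y =>
    (hL n y).trans (mul_le_mul_of_nonneg_right (le_max_left _ _) (Real.rpow_nonneg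
      (Finset.sum_nonneg fun k _ => Real.rpow_nonneg (QuasiBanachSpace.qnorm_nonneg _) _) _))
  obtain ⟨C, hC, hmain⟩ := exists_gaugeNorm_le (K := (C₁ ^ q) ^ (s / q)) hs hs1 (by positivity) hM
  refine ⟨max 1 (C * b / α).toNNReal, le_max_left _ _, ?_⟩
  intro n φ hφ hmul hφ1 hS x a ha
  let f : (Fin n → ℂ) → G → X := fun a g => ∑ k, (a k * φ g k) • x k
  have hfcont : ∀ a, Continuous fun g => QuasiBanachSpace.qnorm ℂ (f a g) := fun a =>
    (continuous_qnorm_sum x).comp (f := fun g k => a k * φ g k) (by fun_prop)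
  have hfin : ∀ a, lpQNorm p (f a) ≠ ∞ := fun a =>
    (memLp_of_continuous p (hfcont a)).eLpNorm_ne_top
  let ρ₀ := krivineGauge fun k => T (x k)
  have hρ₀ : IsConvexGauge s ((C₁ ^ q) ^ (s / q)) ρ₀ :=
    (isConvexGauge_krivineGauge hq hC₁1 hL' _).of_le hs hsq (by positivity)
  have hρ₀add : ∀ H₀ H₁ H₂ : (Fin n → ℂ) → ℝ, IsNonnegHomog H₀ → IsNonnegHomog H₁ →
      IsNonnegHomog H₂ → (∀ t, H₀ t ≤ H₁ t + H₂ t) → ρ₀ H₀ ^ r ≤ ρ₀ H₁ ^ r + ρ₀ H₂ ^ r :=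
    fun _ _ _ => krivineGauge_rpow_le _ hr hadd
  have hρ : IsConvexGauge s ((C₁ ^ q) ^ (s / q)) (lpGauge p (haarProb G) φ ρ₀) :=
    isConvexGauge_lpGauge hρ₀ hs (by positivity) hr hρ₀add hsp hφ
  have hval : ∀ a g, ρ₀ (fun t => linAbs a (φ g * t)) = (T (f a g)).cnorm := by
    intro a g
    simp only [f, map_sum, map_smul]
    rw [cnorm_sum_smul]
    congr 1
    funext t
    simp only [linAbs, Pi.mul_apply, mul_assoc]
  have hρfin : ∀ a, eLpNorm (fun g => ρ₀ fun t => linAbs a (φ g * t)) p (haarProb G) ≠ ∞ :=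
    fun a => (memLp_of_continuous p ((hρ₀.continuous_comp_mul hr hρ₀add
      (isNonnegHomog_linAbs a)).comp hφ)).eLpNorm_ne_top
  have hcn : ∀ z : Complexification L, 0 ≤ z.cnorm := fun z => QuasiBanachSpace.qnorm_nonneg _
  have hup : ∀ a, lpGauge p (haarProb G) φ ρ₀ (linAbs a) ≤ b * (lpQNorm p (f a)).toReal := by
    intro a
    have h1 := eLpNorm_le_mul_eLpNorm_of_ae_le_mul (μ := haarProb G)
      (f := fun g => ρ₀ fun t => linAbs a (φ g * t))
      (g := fun g => QuasiBanachSpace.qnorm ℂ (f a g)) (c := b) (ae_of_all _ fun g => by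
        rw [hval, Real.norm_of_nonneg (hcn _),
          Real.norm_of_nonneg (QuasiBanachSpace.qnorm_nonneg _)]
        exact (hT _).2) p
    have h2 := ENNReal.toReal_mono (ENNReal.mul_ne_top ENNReal.ofReal_ne_top (hfin a)) h1
    rwa [ENNReal.toReal_mul, ENNReal.toReal_ofReal hb.le] at h2
  have hlow : ∀ a, α * (lpQNorm p (f a)).toReal ≤ lpGauge p (haarProb G) φ ρ₀ (linAbs a) := by
    intro a
    have h1 := eLpNorm_le_mul_eLpNorm_of_ae_le_mul (μ := haarProb G)
      (f := fun g => QuasiBanachSpace.qnorm ℂ (f a g))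
      (g := fun g => ρ₀ fun t => linAbs a (φ g * t)) (c := α⁻¹) (ae_of_all _ fun g => by
        rw [hval, Real.norm_of_nonneg (hcn _),
          Real.norm_of_nonneg (QuasiBanachSpace.qnorm_nonneg _), le_inv_mul_iff₀ hα]
        exact (hT _).1) p
    have h2 := ENNReal.toReal_mono (ENNReal.mul_ne_top ENNReal.ofReal_ne_top (hρfin a)) h1
    rwa [ENNReal.toReal_mul, ENNReal.toReal_ofReal (by positivity), le_inv_mul_iff₀ hα] at h2
  have htrans : ∀ (h : G) (z : ℂ), ‖z‖ = 1 → lpQNorm p (f (z • φ h)) = lpQNorm p (f 1) := by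
    intro h z hz
    have e : (fun g => QuasiBanachSpace.qnorm ℂ (f (z • φ h) g)) =
        (fun g => QuasiBanachSpace.qnorm ℂ (f 1 g)) ∘ fun g => h * g := by
      funext g
      have e1 : f (z • φ h) g = z • f 1 (h * g) := by
        simp only [f, hmul, Finset.smul_sum, smul_smul, Pi.smul_apply, Pi.mul_apply, Pi.one_apply,
          smul_eq_mul, one_mul, mul_assoc]
      rw [e1, QuasiBanachSpace.qnorm_smul, hz, one_mul, Function.comp_apply]
    rw [lpQNorm, e]
    exact eLpNorm_comp_measurePreserving (hfcont 1).aestronglyMeasurable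
      (measurePreserving_mul_left _ h)
  have hgauge := hmain n _ (b * (lpQNorm p (f 1)).toReal) hρ (by positivity) (by
    intro a ξ ha hξ
    obtain ⟨a', ha', hdist⟩ := Metric.mem_closure_iff.1 (mem_closure_convexHull_of_sidon hM hS ha)
      ξ hξ
    obtain ⟨ι, _, w, y, hw, hw1, hy, rfl⟩ := mem_convexHull_iff_exists_fintype.1 ha'
    choose g z hz hyz using hy
    refine ⟨ι, inferInstance, fun i => M * w i, fun i => z i • φ (g i),
      fun i => mul_nonneg hM.le (hw i), by rw [← Finset.mul_sum, hw1, mul_one], fun i k => ?_,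
      fun i => ?_, fun k => ?_⟩
    · change ‖z i * φ (g i) k‖ ≤ 1
      rw [norm_mul, hz, hφ1, mul_one]
    · rw [← htrans (g i) (z i) (hz i)]
      exact hup _
    · have e : ∑ i, (M * w i) • z i • φ (g i) = ∑ i, w i • y i := by
        refine Finset.sum_congr rfl fun i _ => ?_
        rw [hyz, mul_comm, mul_smul]
        rfl
      rw [e]
      rw [dist_eq_norm] at hdist
      exact (norm_le_pi_norm _ k).trans hdist.le)
  have h1 := (hlow a).trans ((hρ.le_gaugeNorm ha).trans hgauge)
  have h2 : (lpQNorm p (f a)).toReal ≤ C * b / α * (lpQNorm p (f 1)).toReal := by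
    rw [div_mul_eq_mul_div, le_div_iff₀ hα]
    linarith
  have h3 : lpQNorm p (f a) ≤ (C * b / α).toNNReal * lpQNorm p (f 1) := by
    rw [← ENNReal.toReal_le_toReal (hfin a) (ENNReal.mul_ne_top ENNReal.coe_ne_top (hfin 1)),
      ENNReal.toReal_mul, ENNReal.coe_toReal, Real.coe_toNNReal _ (by positivity)]
    exact h2
  have h4 := h3.trans (mul_le_mul_left (ENNReal.coe_le_coe.2
    (le_max_right 1 (C * b / α).toNNReal)) _)
  simpa only [f, Pi.one_apply, one_mul] using h4

end

/-! ### Comparison of two systems of characters -/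

section

variable {X : Type*} [AddCommGroup X] [Module ℂ X] [QuasiBanachSpace ℂ X]

/-- Two systems of unimodular functions that admit multipliers are equivalent: expand
`∑ φ_k(g) ψ_k(h) x_k` in each of the two variables. -/
theorem lpQNorm_le_of_multiplier_bound {G H : Type*}
    [Group G] [TopologicalSpace G] [IsTopologicalGroup G] [CompactSpace G]
    [MeasurableSpace G] [BorelSpace G]
    [Group H] [TopologicalSpace H] [IsTopologicalGroup H] [CompactSpace H]
    [MeasurableSpace H] [BorelSpace H]
    {p : ℝ≥0∞} (hp : 0 < p) {n : ℕ} {φ : G → Fin n → ℂ} {ψ : H → Fin n → ℂ}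
    (hφ : Continuous φ) (hψ : Continuous ψ) (hφ1 : ∀ g k, ‖φ g k‖ = 1) (hψ1 : ∀ h k, ‖ψ h k‖ = 1)
    (hψ_one : ψ 1 = 1) {C D : ℝ≥0} (hC : 1 ≤ C)
    (hφC : ∀ (x : Fin n → X) (a : Fin n → ℂ), (∀ k, ‖a k‖ ≤ 1) →
      lpQNorm p (fun g => ∑ k, (a k * φ g k) • x k) ≤ C * lpQNorm p (fun g => ∑ k, φ g k • x k))
    (hψD : ∀ (x : Fin n → X) (a : Fin n → ℂ), (∀ k, ‖a k‖ ≤ 1) →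
      lpQNorm p (fun h => ∑ k, (a k * ψ h k) • x k) ≤ D * lpQNorm p (fun h => ∑ k, ψ h k • x k))
    (x : Fin n → X) :
    lpQNorm p (fun g => ∑ k, φ g k • x k) ≤
      (C * D : ℝ≥0) * lpQNorm p (fun h => ∑ k, ψ h k • x k) := by
  set S := lpQNorm p (fun g => ∑ k, φ g k • x k)
  set R := lpQNorm p (fun h => ∑ k, ψ h k • x k)
  let N : (Fin n → ℂ) → ℝ := fun c => QuasiBanachSpace.qnorm ℂ (∑ k, c k • x k)
  have hN : Continuous N := continuous_qnorm_sum x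
  have hR : ∀ g, eLpNorm (fun h => N (φ g * ψ h)) p (haarProb H) ≤ D * R := fun g =>
    hψD x (φ g) fun k => (hφ1 g k).le
  rcases eq_or_ne p ∞ with rfl | hp'
  · have hval : ∀ g, ‖N (φ g)‖ₑ ≤ D * R := by
      intro g
      refine le_trans ?_ (hR g)
      rw [eLpNorm_exponent_top]
      have hc : Continuous fun h => ‖N (φ g * ψ h)‖ₑ :=
        (hN.comp (continuous_const.mul hψ)).enorm
      have hae := enorm_ae_le_eLpNormEssSup (fun h => N (φ g * ψ h)) (haarProb H)
      -- The set on which the bound holds is closed and has full measure, so it contains `1`.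
      have h1 := (Measure.dense_of_ae (μ := haarProb H) hae) 1
      rw [(isClosed_le hc continuous_const).closure_eq] at h1
      simpa only [Set.mem_ofPred_eq, hψ_one, mul_one] using h1
    refine (eLpNormEssSup_le_of_ae_enorm_bound (ae_of_all _ hval)).trans ?_
    gcongr
    exact le_mul_of_one_le_left zero_le hC
  · set P := p.toReal
    have hP : 0 < P := ENNReal.toReal_pos hp.ne' hp'
    have hG : ∀ f : G → ℝ,
        eLpNorm f p (haarProb G) ^ P = ∫⁻ g, ‖f g‖ₑ ^ P ∂haarProb G := fun f => by
      rw [eLpNorm_eq_lintegral_rpow_enorm_toReal hp.ne' hp', ← ENNReal.rpow_mul,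
        one_div_mul_cancel hP.ne', ENNReal.rpow_one]
    have hH : ∀ f : H → ℝ,
        eLpNorm f p (haarProb H) ^ P = ∫⁻ h, ‖f h‖ₑ ^ P ∂haarProb H := fun f => by
      rw [eLpNorm_eq_lintegral_rpow_enorm_toReal hp.ne' hp', ← ENNReal.rpow_mul,
        one_div_mul_cancel hP.ne', ENNReal.rpow_one]
    have hS : ∀ h, S ≤ C * eLpNorm (fun g => N (φ g * ψ h)) p (haarProb G) := by
      intro h
      have h1 := hφC (fun k => ψ h k • x k) (fun k => (starRingEnd ℂ) (ψ h k)) fun k => by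
        rw [RCLike.norm_conj, hψ1]
      have e : ∀ g k, ((starRingEnd ℂ) (ψ h k) * φ g k) • ψ h k • x k = φ g k • x k := fun g k => by
        rw [smul_smul, mul_right_comm, Complex.conj_mul', hψ1]
        simp
      simp only [e, smul_smul] at h1
      exact h1
    have hmeas : AEMeasurable (Function.uncurry fun h g => ‖N (φ g * ψ h)‖ₑ ^ P)
        ((haarProb H).prod (haarProb G)) := by
      refine Measurable.aemeasurable (Measurable.pow_const (Measurable.enorm ?_) _)
      exact hN.measurable.comp ((hφ.measurable.comp measurable_snd).mul
        (hψ.measurable.comp measurable_fst))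
    have hpow : S ^ P ≤ ((C * D : ℝ≥0) * R) ^ P := by
      calc S ^ P = ∫⁻ _h : H, S ^ P ∂haarProb H := by simp
        _ ≤ ∫⁻ h, C ^ P * ∫⁻ g, ‖N (φ g * ψ h)‖ₑ ^ P ∂haarProb G ∂haarProb H := by
          refine lintegral_mono fun h => ?_
          rw [← hG, ← ENNReal.mul_rpow_of_nonneg _ _ hP.le]
          exact ENNReal.rpow_le_rpow (hS h) hP.le
        _ = C ^ P * ∫⁻ g, ∫⁻ h, ‖N (φ g * ψ h)‖ₑ ^ P ∂haarProb H ∂haarProb G := by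
          rw [lintegral_const_mul' _ _ (ENNReal.rpow_ne_top_of_nonneg hP.le ENNReal.coe_ne_top),
            lintegral_lintegral_swap hmeas]
        _ ≤ C ^ P * ∫⁻ _g : G, (D * R) ^ P ∂haarProb G := by
          gcongr with g
          rw [← hH]
          exact ENNReal.rpow_le_rpow (hR g) hP.le
        _ = ((C * D : ℝ≥0) * R) ^ P := by
          rw [lintegral_const, measure_univ, mul_one, ← ENNReal.mul_rpow_of_nonneg _ _ hP.le,
            ← mul_assoc, ENNReal.coe_mul]
    exact (ENNReal.rpow_le_rpow_iff hP).1 hpow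

end

/-! ### The Rademacher functions -/

theorem continuous_rademacher (k : ℕ) : Continuous (rademacher k) :=
  (continuous_of_discreteTopology (f := fun e : ℤˣ => ((e : ℤ) : ℂ))).comp (continuous_apply k)

theorem norm_rademacher (k : ℕ) (t : CantorGroup) : ‖rademacher k t‖ = 1 := by
  rcases Int.units_eq_one_or (t k) with h | h <;> simp [rademacher, h]

/-- The Rademacher functions form a Sidon set with constant `2`. -/
theorem sum_norm_le_iSup_rademacher {n : ℕ} (β : Fin n → ℂ) :
    ∑ k, ‖β k‖ ≤ 2 * ⨆ t : CantorGroup, ‖∑ k : Fin n, β k * rademacher k t‖ := by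
  have hbdd : BddAbove (Set.range fun t : CantorGroup => ‖∑ k : Fin n, β k * rademacher k t‖) := by
    refine ⟨∑ k, ‖β k‖, ?_⟩
    rintro _ ⟨t, rfl⟩
    refine (norm_sum_le _ _).trans (Finset.sum_le_sum fun k _ => ?_)
    rw [norm_mul, norm_rademacher, mul_one]
  -- The coordinates of `t` with index `k < n` are the signs of the `b k`.
  have key : ∀ b : Fin n → ℝ, ∃ t : CantorGroup, ∀ k : Fin n,
      rademacher k t = ((|b k| / b k : ℝ) : ℂ) ∨ b k = 0 := by
    intro b
    refine ⟨fun j => if h : j < n then (if 0 ≤ b ⟨j, h⟩ then 1 else -1) else 1, fun k => ?_⟩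
    rcases lt_trichotomy (b k) 0 with h | h | h
    · left
      simp [rademacher, not_le.2 h, abs_of_neg h, neg_div, div_self h.ne]
    · exact Or.inr h
    · left
      simp [rademacher, h.le, abs_of_pos h, div_self h.ne']
  have hmul : ∀ (b : ℝ) (e : ℂ), e = ((|b| / b : ℝ) : ℂ) ∨ b = 0 → b * e.re = |b| := by
    rintro b e (rfl | rfl)
    · rw [Complex.ofReal_re]
      rcases eq_or_ne b 0 with rfl | h
      · simp
      · field_simp
    · simp
  have him : ∀ (k : ℕ) (t : CantorGroup), (rademacher k t).im = 0 := fun k t => by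
    simp [rademacher]
  have hre : ∑ k, |(β k).re| ≤ ⨆ t : CantorGroup, ‖∑ k : Fin n, β k * rademacher k t‖ := by
    obtain ⟨t, ht⟩ := key fun k => (β k).re
    refine le_trans ?_ (le_ciSup hbdd t)
    refine le_trans (le_of_eq ?_) (Complex.re_le_norm _)
    rw [Complex.re_sum]
    refine Finset.sum_congr rfl fun k _ => ?_
    rw [Complex.mul_re, him, mul_zero, sub_zero, hmul _ _ (ht k)]
  have him' : ∑ k, |(β k).im| ≤ ⨆ t : CantorGroup, ‖∑ k : Fin n, β k * rademacher k t‖ := by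
    obtain ⟨t, ht⟩ := key fun k => (β k).im
    refine le_trans ?_ (le_ciSup hbdd t)
    refine le_trans (le_of_eq ?_) ((le_abs_self _).trans (Complex.abs_im_le_norm _))
    rw [Complex.im_sum]
    refine Finset.sum_congr rfl fun k _ => ?_
    rw [Complex.mul_im, him, mul_zero, zero_add, hmul _ _ (ht k)]
  have := Finset.sum_le_sum fun k (_ : k ∈ Finset.univ) => Complex.norm_le_abs_re_add_abs_im (β k)
  rw [Finset.sum_add_distrib] at this
  linarith

/-! ### Property `𝒞_p(X)` of Sidon sets -/

theorem theorem4 {G : Type*} [CommGroup G] [TopologicalSpace G] [IsTopologicalGroup G]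
    [CompactSpace G] [T2Space G] [MeasurableSpace G] [BorelSpace G]
    {X : Type u} [AddCommGroup X] [Module ℂ X] [QuasiBanachSpace ℂ X]
    (hX : IsNatural.{u, v} X) (p : ℝ≥0∞) (hp : 0 < p)
    (E : Set (PontryaginDual G)) (hE : IsSidon E) :
    HasPropertyC p X E := by
  obtain ⟨M, hM⟩ := hE
  obtain ⟨C, hC, hCG⟩ := exists_multiplier_bound (G := G) hX hp (M := max M 1) (by positivity)
  obtain ⟨D, hD, hDΔ⟩ := exists_multiplier_bound (G := CantorGroup) hX hp (M := 2) two_pos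
  have hCD : 0 < C * D := by positivity
  refine ⟨C * D, hCD, fun n γ x hγ hγE => ?_⟩
  let φ : G → Fin n → ℂ := fun g k => ((γ k g : Circle) : ℂ)
  let ψ : CantorGroup → Fin n → ℂ := fun t k => rademacher k t
  have hφ : Continuous φ :=
    continuous_pi fun k => continuous_subtype_val.comp (map_continuous (γ k))
  have hψ : Continuous ψ := continuous_pi fun k => continuous_rademacher k
  have hφ1 : ∀ g k, ‖φ g k‖ = 1 := fun g k => Circle.norm_coe _
  have hψ1 : ∀ t k, ‖ψ t k‖ = 1 := fun t k => norm_rademacher k t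
  have hφmul : ∀ g h, φ (g * h) = φ g * φ h := fun g h => by
    funext k
    simp [φ]
  have hψmul : ∀ g h, ψ (g * h) = ψ g * ψ h := fun g h => by
    funext k
    simp [ψ, rademacher]
  have hSidon : ∀ β : Fin n → ℂ, ∑ k, ‖β k‖ ≤ max M 1 * ⨆ g, ‖∑ k, β k * φ g k‖ := by
    intro β
    have h := hM (Finset.univ.map ⟨γ, hγ⟩) (Function.extend γ β 0) (by
      intro χ hχ
      simp only [Finset.coe_map, Function.Embedding.coeFn_mk, Finset.coe_univ, Set.image_univ,
        Set.mem_range] at hχ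
      obtain ⟨k, rfl⟩ := hχ
      exact hγE k)
    simp only [Finset.sum_map, Function.Embedding.coeFn_mk, hγ.extend_apply] at h
    exact h.trans (mul_le_mul_of_nonneg_right (le_max_left _ _)
      (Real.iSup_nonneg fun _ => norm_nonneg _))
  have hG := hCG n φ hφ hφmul hφ1 hSidon
  have hΔ := hDΔ n ψ hψ hψmul hψ1 sum_norm_le_iSup_rademacher
  have hφ_one : φ 1 = 1 := by
    funext k
    simp [φ]
  have hψ_one : ψ 1 = 1 := by
    funext k
    simp [ψ, rademacher]
  constructor
  · have := lpQNorm_le_of_multiplier_bound hp hψ hφ hψ1 hφ1 hφ_one hD hΔ hG x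
    rw [mul_comm D C] at this
    rwa [mul_comm, ← div_eq_mul_inv, ENNReal.div_le_iff (by exact_mod_cast hCD.ne')
      ENNReal.coe_ne_top, mul_comm]
  · exact lpQNorm_le_of_multiplier_bound hp hφ hψ hφ1 hψ1 hψ_one hC hG hΔ x
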